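/- Let $H$ be a countable (discrete) group. For $g\in H$ write $\mathscr O_H(g)=\{hgh^{-1}: h\in H\}$. Let $H^{fc}=\{g\in H: |\mathscr O_H(g)|<\infty\}$ be the FC-center of $H$, and let $H^{hfc}$ be the hyper-FC center of $H$, i.e. the term at which the transfinite upper FC-series of $H$ stabilizes; this is the increasing series of normal subgroups $H^h_\alpha$ with $H^h_0=\{1\}$, $H^h_{\alpha+1}/H^h_\alpha=(H/H^h_\alpha)^{fc}$, and $H^h_\alpha=\bigcup_{\beta<\alpha}H^h_\beta$ for limit ordinals $\alpha$. A subgroup $S\leqslant H$ is BFC inside $H$ if $\sup_{g\in S}|\mathscr O_H(g)|<\infty$. For $S\leqslant H$ let $\mathcal L(S)=\{u_s : s\in S\}''\subseteq B(\ell^2(H))$, where $u_s$ is left translation by $s$, and let $\mathscr Z(\mathcal L(H))$ be the center of $\mathcal L(H)$. For von Neumann subalgebras $\mathcal N_1,\mathcal N_2\subseteq\mathcal M$, write $\mathcal N_1\prec_{\mathcal M}\mathcal N_2$ (Popa's intertwining) if there are nonzero projections $p\in\mathcal N_1$, $q\in\mathcal N_2$, a $*$-homomorphism $\Theta:p\mathcal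 N_1p\to q\mathcal N_2q$ and a nonzero partial isometry $v\in q\mathcal Mp$ such that $\Theta(x)v=vx$ for all $x\in p\mathcal N_1p$. Then the following are equivalent: (1) $H^{fc}$ is BFC inside $H$ and $[H^{hfc}:H^{fc}]<\infty$; (2) $\mathcal L(H^{hfc})\prec_{\mathcal L(H)}\mathscr Z(\mathcal L(H))$. Moreover, if $\mathcal L(H^{fc})\prec_{\mathcal L(H)}\mathscr Z(\mathcal L(H))$, then the commutator subgroup $[H^{fc},H^{fc}]$ is finite. -/

import Mathlib

/-! ### The FC-center, the hyper-FC center, and relative BFC subgroups -/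

/-- The conjugacy class `{h g h⁻¹ : h ∈ H}` of `g` in the group `H`. -/
def conjClass {H : Type*} [Group H] (g : H) : Set H :=
  Set.range fun h : H => h * g * h⁻¹

/-- The FC-center of a group: all elements whose conjugacy class is finite. -/
def fcCenter (H : Type*) [Group H] : Subgroup H where
  carrier := {g | (conjClass g).Finite}
  one_mem' := by
    refine (Set.finite_singleton (1 : H)).subset ?_
    rintro _ ⟨h, rfl⟩
    simp
  mul_mem' := by
    intro a b ha hb
    refine (ha.image2 (fun x y => x * y) hb).subset ?_
    rintro _ ⟨h, rfl⟩
    exact ⟨h * a * h⁻¹, ⟨h, rfl⟩, h * b * h⁻¹, ⟨h, rfl⟩, by group⟩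
  inv_mem' := by
    intro a ha
    refine (ha.image fun x => x⁻¹).subset ?_
    rintro _ ⟨h, rfl⟩
    exact ⟨h * a * h⁻¹, ⟨h, rfl⟩, by group⟩

instance fcCenter_normal (H : Type*) [Group H] : (fcCenter H).Normal where
  conj_mem := by
    intro a ha g
    refine Set.Finite.subset ha ?_
    rintro _ ⟨h, rfl⟩
    exact ⟨h * g, by group⟩

/-- The successor step of the upper FC-series: the normal subgroup `M ≥ N` of `H` such that
`M / N` is the FC-center of `H / N`. -/
def fcStep {H : Type*} [Group H] (N : {N : Subgroup H // N.Normal}) :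
    {N : Subgroup H // N.Normal} :=
  haveI := N.2
  ⟨(fcCenter (H ⧸ N.1)).comap (QuotientGroup.mk' N.1), inferInstance⟩

/-- The (transfinite) upper FC-series of `H`, a series of normal subgroups: it starts at the
trivial subgroup, its successor step is `fcStep`, and at a limit ordinal it is the union (that is,
the supremum) of the earlier terms. -/
noncomputable def upperFCSeries.{u} (H : Type u) [Group H] (α : Ordinal.{u}) :
    {N : Subgroup H // N.Normal} :=
  Ordinal.limitRecOn (motive := fun _ => {N : Subgroup H // N.Normal}) α
    ⟨⊥, inferInstance⟩
    (fun _ N => fcStep N)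
    (fun β _ ih =>
      haveI : ∀ γ : Set.Iio β, ((ih γ.1 γ.2).1).Normal := fun γ => (ih γ.1 γ.2).2
      ⟨⨆ γ : Set.Iio β, (ih γ.1 γ.2).1, inferInstance⟩)

/-- The hyper-FC center of `H`: the union of the upper FC-series over all ordinals, i.e. the term
at which this increasing series stabilizes. -/
noncomputable def hyperFCCenter.{u} (H : Type u) [Group H] : Subgroup H :=
  ⨆ α : Ordinal.{u}, (upperFCSeries H α).1

/-- The subgroup `S` is BFC inside `H`: the conjugacy classes in `H` of the elements of `S` have
uniformly bounded (finite) size. -/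
def IsBFCInside {H : Type*} [Group H] (S : Subgroup H) : Prop :=
  ∃ C : ℕ, ∀ g ∈ S, (conjClass g).encard ≤ C

/-! ### Von Neumann algebras of operators, their centers and corners -/

section VN

variable {E : Type*} [NormedAddCommGroup E] [InnerProductSpace ℂ E] [CompleteSpace E]

/-- The von Neumann algebra `(S ∪ S*)''` generated by a set `S` of bounded operators. -/
noncomputable def vnGenerated (S : Set (E →L[ℂ] E)) : VonNeumannAlgebra E where
  toStarSubalgebra := StarSubalgebra.centralizer ℂ (StarSubalgebra.centralizer ℂ S : Set (E →L[ℂ] E))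
  centralizer_centralizer' := by
    change Set.centralizer (Set.centralizer
      (StarSubalgebra.centralizer ℂ (StarSubalgebra.centralizer ℂ S : Set (E →L[ℂ] E)) :
        Set (E →L[ℂ] E))) =
      (StarSubalgebra.centralizer ℂ (StarSubalgebra.centralizer ℂ S : Set (E →L[ℂ] E)) :
        Set (E →L[ℂ] E))
    rw [StarSubalgebra.coe_centralizer_centralizer, Set.centralizer_centralizer_centralizer]

/-- The center `M ∩ M'` of a von Neumann algebra `M`. -/
noncomputable def vnCenter (M : VonNeumannAlgebra E) : VonNeumannAlgebra E where
  toStarSubalgebra := M.toStarSubalgebra ⊓ M.commutant.toStarSubalgebra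
  centralizer_centralizer' := by
    have h : ((M : Set (E →L[ℂ] E)) ∩ (M.commutant : Set (E →L[ℂ] E))) =
        Set.centralizer ((M.commutant : Set (E →L[ℂ] E)) ∪ (M : Set (E →L[ℂ] E))) := by
      rw [Set.centralizer_union, ← VonNeumannAlgebra.coe_commutant,
        ← VonNeumannAlgebra.coe_commutant, VonNeumannAlgebra.commutant_commutant]
    change Set.centralizer (Set.centralizer
      ((M : Set (E →L[ℂ] E)) ∩ (M.commutant : Set (E →L[ℂ] E)))) =
      ((M : Set (E →L[ℂ] E)) ∩ (M.commutant : Set (E →L[ℂ] E)))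
    rw [h, Set.centralizer_centralizer_centralizer]

/-- The corner `p N p` of a von Neumann algebra `N` at a projection `p ∈ N`, as a (not necessarily
unital) `*`-subalgebra of the algebra of all bounded operators. -/
noncomputable def vnCorner (N : VonNeumannAlgebra E) (p : E →L[ℂ] E) (hp : IsStarProjection p)
    (hpN : p ∈ N) : NonUnitalStarSubalgebra ℂ (E →L[ℂ] E) where
  carrier := {x | ∃ y ∈ N, p * y * p = x}
  zero_mem' := ⟨0, zero_mem N, by simp⟩
  add_mem' := by
    rintro _ _ ⟨x, hx, rfl⟩ ⟨y, hy, rfl⟩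
    exact ⟨x + y, add_mem hx hy, by rw [mul_add, add_mul]⟩
  mul_mem' := by
    rintro _ _ ⟨x, hx, rfl⟩ ⟨y, hy, rfl⟩
    have h : p * p = p := hp.isIdempotentElem
    refine ⟨x * p * y, mul_mem (mul_mem hx hpN) hy, ?_⟩
    calc p * (x * p * y) * p = p * x * p * (y * p) := by simp only [mul_assoc]
      _ = p * x * (p * p) * (y * p) := by rw [h]
      _ = p * x * p * (p * y * p) := by simp only [mul_assoc]
  smul_mem' := by
    rintro c _ ⟨x, hx, rfl⟩
    exact ⟨c • x, N.toStarSubalgebra.smul_mem hx c, by simp⟩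
  star_mem' := by
    rintro _ ⟨x, hx, rfl⟩
    have h : star p = p := hp.isSelfAdjoint
    exact ⟨star x, star_mem hx, by simp only [star_mul, h, mul_assoc]⟩

/-- Popa's intertwining relation `N₁ ≺_M N₂` (a corner of `N₁` embeds into `N₂` inside `M`) for
von Neumann subalgebras `N₁, N₂ ⊆ M`: there are nonzero projections `p ∈ N₁`, `q ∈ N₂`, a
`*`-homomorphism `Θ : p N₁ p → q N₂ q` and a nonzero partial isometry `v ∈ q M p` with
`Θ(x) v = v x` for all `x ∈ p N₁ p`. -/
def Intertwines (M N₁ N₂ : VonNeumannAlgebra E) : Prop :=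
  ∃ (p q : E →L[ℂ] E) (hp : IsStarProjection p) (hq : IsStarProjection q)
    (hpN : p ∈ N₁) (hqN : q ∈ N₂),
    p ≠ 0 ∧ q ≠ 0 ∧
    ∃ (Θ : vnCorner N₁ p hp hpN →⋆ₙₐ[ℂ] vnCorner N₂ q hq hqN) (v : E →L[ℂ] E),
      (∃ y ∈ M, q * y * p = v) ∧ v * star v * v = v ∧ v ≠ 0 ∧
      ∀ x : vnCorner N₁ p hp hpN, (Θ x : E →L[ℂ] E) * v = v * (x : E →L[ℂ] E)

end VN

/-! ### Group von Neumann algebras -/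

/-- The left translation `(u_g f)(x) = f (g⁻¹ x)` on `ℓ²(H)`. -/
noncomputable def leftTranslation {H : Type*} [Group H] (g : H) :
    lp (fun _ : H => ℂ) 2 →L[ℂ] lp (fun _ : H => ℂ) 2 :=
  LinearMap.mkContinuous
    { toFun := fun f => ⟨fun x => f (g⁻¹ * x), by
        have hf := (memℓp_gen_iff (by norm_num)).1 f.2
        exact (memℓp_gen_iff (by norm_num)).2 ((Equiv.mulLeft g⁻¹).summable_iff.2 hf)⟩
      map_add' := fun _ _ => rfl
      map_smul' := fun _ _ => rfl } 1 (by
      intro f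
      rw [one_mul, lp.norm_eq_tsum_rpow (by norm_num), lp.norm_eq_tsum_rpow (by norm_num)]
      apply le_of_eq
      congr 1
      exact (Equiv.mulLeft g⁻¹).tsum_eq fun x => ‖f x‖ ^ (2 : ENNReal).toReal)

/-- For a subgroup `S ≤ H`, the von Neumann subalgebra `L(S) = {u_s : s ∈ S}''` of `L(H)`, acting
on `ℓ²(H)`. -/
noncomputable def groupVN {H : Type*} [Group H] (S : Subgroup H) :
    VonNeumannAlgebra (lp (fun _ : H => ℂ) 2) :=
  vnGenerated (leftTranslation '' (S : Set H))

/-! Write K for the FC-center, `N` for `L(S)` and Z for the center of `L(H)`. The equivalence holds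
for every subgroup S containing K; the hyper-FC center enters only through that containment.

Intertwining implies finiteness. An element of Z has constant coefficients on conjugacy classes, so
its coefficient on a class with at least n elements is at most its norm divided by √n. An
intertwiner v gives e = v*v with e x = Θ(x) e, so the corner `p N p` acts on e by central operators.
If a net s_i in S had the classes of s_i k growing without bound for every k, then e u_{s_i} would
tend strongly to 0; but e commutes with right translations, so ‖e δ_{s_i}‖ = ‖e δ_1‖, forcing e = 0.
Hence there are a finite E and a C such that every s in S has some k in E with the class of s k of
size at most C (`Intertwines.exists_finset`). Both the bound on classes in K and the finite index of
K in S follow.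

BFC implies finite commutators. A Neumann-type argument (`IsBFCInside.exists_finite_commutators`)
finds a finite index subgroup having only finitely many commutators with K. This gives finiteness of
[K, K], and also a normal finite index L ≥ K with F = [L, K] finite.

Finiteness implies intertwining. The average e_F over F is a central projection, and conjugation by
L is trivial on `L(K)` e_F. Averaging over H/L therefore dominates positive elements of `L(K)` e_F
by central ones of comparable trace, while the pinching inequality compares `L(S)` with `L(K)`. So a
projection of `L(S)` below e_F has trace at least a fixed fraction of that of its central support
(`exists_traceRe_centralSupport_le`). This bounds the number of orthogonal projections with a common
central support, so repeated splitting stops at a nonzero p whose orthogonal subprojections have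
orthogonal central supports. For such p, every element of `p N p` has the form a p with a in Z, and
sending it to a intertwines, with v = p. -/

/-! ### Bounded conjugacy classes -/

/-- The set of conjugates of `k` by elements of the subgroup `G`. -/
def classIn {H : Type*} [Group H] (G : Subgroup H) (k : H) : Set H :=
  (fun g => g * k * g⁻¹) '' (G : Set H)

section BFC

variable {H : Type*} [Group H]

theorem classIn_subset_conjClass (G : Subgroup H) (k : H) : classIn G k ⊆ conjClass k := by
  rintro _ ⟨g, -, rfl⟩
  exact ⟨g, rfl⟩

theorem classIn_mono {G G' : Subgroup H} (h : G ≤ G') (k : H) : classIn G k ⊆ classIn G' k :=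
  Set.image_mono h

theorem finiteIndex_centralizer_of_finite_conjClass {g : H} (hg : (conjClass g).Finite) :
    (Subgroup.centralizer {g}).FiniteIndex := by
  have : Finite (conjClass g) := hg
  have hC : ∀ a b : H, a⁻¹ * b ∈ Subgroup.centralizer {g} ↔ a * g * a⁻¹ = b * g * b⁻¹ := by
    intro a b
    rw [Subgroup.mem_centralizer_singleton_iff]
    constructor
    · intro h
      calc a * g * a⁻¹ = a * (g * (a⁻¹ * b)) * b⁻¹ := by group
        _ = a * (a⁻¹ * b * g) * b⁻¹ := by rw [h]
        _ = b * g * b⁻¹ := by group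
    · intro h
      calc a⁻¹ * b * g = a⁻¹ * (b * g * b⁻¹) * b := by group
        _ = a⁻¹ * (a * g * a⁻¹) * b := by rw [h]
        _ = g * (a⁻¹ * b) := by group
  let f : H ⧸ Subgroup.centralizer {g} → conjClass g :=
    Quotient.lift (fun a => ⟨a * g * a⁻¹, a, rfl⟩) (by
      intro a b hab
      exact Subtype.ext ((hC a b).1 (QuotientGroup.leftRel_apply.1 hab)))
  have hf : Function.Injective f := by
    rintro ⟨a⟩ ⟨b⟩ hab
    exact QuotientGroup.eq.2 ((hC a b).2 (congrArg Subtype.val hab))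
  have := Finite.of_injective f hf
  exact Subgroup.finiteIndex_of_finite_quotient

theorem IsBFCInside.finite_conjClass {K : Subgroup H} (hK : IsBFCInside K) {k : H} (hk : k ∈ K) :
    (conjClass k).Finite := by
  obtain ⟨C, hC⟩ := hK
  exact Set.finite_of_encard_le_coe (hC k hk)

/-- Among the finite index subgroups there is one for which the maximal size of a class of an
element of `K` is as small as possible. -/
theorem IsBFCInside.exists_minimal {K : Subgroup H} (hK : IsBFCInside K) :
    ∃ (n : ℕ) (G : Subgroup H), G.FiniteIndex ∧ (∀ k ∈ K, (classIn G k).encard ≤ n) ∧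
      ∀ G' : Subgroup H, G'.FiniteIndex → ∃ k ∈ K, n ≤ (classIn G' k).encard := by
  classical
  have hex : ∃ n : ℕ, ∃ G : Subgroup H, G.FiniteIndex ∧ ∀ k ∈ K, (classIn G k).encard ≤ n := by
    obtain ⟨C, hC⟩ := hK
    exact ⟨C, ⊤, inferInstance, fun k hk =>
      (Set.encard_le_encard (classIn_subset_conjClass _ _)).trans (hC k hk)⟩
  obtain ⟨G, hG, hGn⟩ := Nat.find_spec hex
  refine ⟨Nat.find hex, G, hG, hGn, fun G' hG' => ?_⟩
  by_contra! hlt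
  rcases hn : Nat.find hex with _ | m
  · have := hlt 1 K.one_mem
    simp [hn] at this
  · refine Nat.find_min hex (m := m) (by omega) ⟨G', hG', fun k hk => ?_⟩
    have := hlt k hk
    rw [hn] at this
    push_cast at this
    exact Order.le_of_lt_add_one this

theorem finiteIndex_biInf_centralizer (s : Finset H) (h : ∀ k ∈ s, (conjClass k).Finite) :
    (⨅ k ∈ s, Subgroup.centralizer {k}).FiniteIndex := by
  classical
  induction s using Finset.induction_on with
  | empty => simpa using (inferInstance : (⊤ : Subgroup H).FiniteIndex)
  | insert a s ha ih =>
    rw [Finset.iInf_insert]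
    have := finiteIndex_centralizer_of_finite_conjClass (h a (Finset.mem_insert_self _ _))
    have := ih fun k hk => h k (Finset.mem_insert_of_mem hk)
    infer_instance

/-- If the elements of `K` have boundedly many conjugates, then a finite index subgroup has only
finitely many commutators with elements of `K`. -/
theorem IsBFCInside.exists_finite_commutators {K : Subgroup H} (hK : IsBFCInside K) :
    ∃ G : Subgroup H, G.FiniteIndex ∧ ∃ D : Set H, D.Finite ∧
      ∀ g ∈ G, ∀ k ∈ K, g * k * g⁻¹ * k⁻¹ ∈ D := by
  classical
  obtain ⟨n, G, hG, hGn, hmin⟩ := hK.exists_minimal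
  -- Pairs (u_i, G_i) are built so that each G_j centralizes all earlier u_i. Finitely many
  -- centralizers of elements of K meet in finite index, so minimality of n still supplies a u whose
  -- class under the smaller group has at least n elements.
  obtain ⟨f, hf, hfr⟩ := exists_seq_of_forall_finset_exists
    (fun a : H × Subgroup H => a.1 ∈ K ∧ a.2 ≤ G ∧ n ≤ (classIn a.2 a.1).encard)
    (fun a b => b.2 ≤ Subgroup.centralizer {a.1}) (by
      intro s hs
      have h1 := finiteIndex_biInf_centralizer (s.image Prod.fst) (by
        intro k hk
        obtain ⟨a, ha, rfl⟩ := Finset.mem_image.1 hk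
        exact hK.finite_conjClass (hs a ha).1)
      obtain ⟨u, hu, hun⟩ := hmin (G ⊓ ⨅ k ∈ s.image Prod.fst, Subgroup.centralizer {k})
        inferInstance
      refine ⟨(u, G ⊓ ⨅ k ∈ s.image Prod.fst, Subgroup.centralizer {k}), ⟨hu, inf_le_left, hun⟩,
        fun a ha => inf_le_right.trans (iInf₂_le a.1 (Finset.mem_image_of_mem _ ha))⟩)
  have hfin : ∀ k ∈ K, (classIn G k).Finite := fun k hk => Set.finite_of_encard_le_coe (hGn k hk)
  have hclass : ∀ i, classIn (f i).2 (f i).1 = classIn G (f i).1 := fun i =>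
    (hfin _ (hf i).1).eq_of_subset_of_encard_le' (classIn_mono (hf i).2.1 _)
      ((hGn _ (hf i).1).trans (hf i).2.2)
  refine ⟨G, hG, ⋃ i ∈ Finset.range (n + 1),
    Set.image2 (fun a b => a⁻¹ * b) (classIn G (f i).1) (classIn G (f i).1),
    Set.Finite.biUnion (Finset.finite_toSet _) fun i _ =>
      (hfin _ (hf i).1).image2 _ (hfin _ (hf i).1), ?_⟩
  intro g hg k hk
  -- For some i ≤ n the centralizer of k in G acts transitively on the G-class of u_i. Otherwise
  -- choose γ_i in G_i moving u_i to a point this centralizer misses. For i < j, γ_j fixes u_i, so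
  -- equality of γ_i⁻¹ k γ_i and γ_j⁻¹ k γ_j would put γ_i γ_j⁻¹ in the centralizer and reach that
  -- point. This yields n + 1 distinct conjugates of k.
  have key : ∃ i ∈ Finset.range (n + 1), ∀ x ∈ classIn G (f i).1,
      ∃ π ∈ G, π * k * π⁻¹ = k ∧ π * (f i).1 * π⁻¹ = x := by
    by_contra! hcon
    have hch : ∀ i : Fin (n + 1), ∃ g ∈ (f i).2, ∀ π ∈ G, π * k * π⁻¹ = k →
        π * (f i).1 * π⁻¹ ≠ g * (f i).1 * g⁻¹ := by
      intro i
      obtain ⟨x, hx, hxn⟩ := hcon i (Finset.mem_range.2 i.2)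
      rw [← hclass] at hx
      obtain ⟨g, hg, rfl⟩ := hx
      exact ⟨g, hg, hxn⟩
    choose γ hγ hγn using hch
    have hlt : ∀ i j : Fin (n + 1), i < j → (γ i)⁻¹ * k * γ i ≠ (γ j)⁻¹ * k * γ j := by
      intro i j hij heq
      refine hγn i (γ i * (γ j)⁻¹) (G.mul_mem ((hf i).2.1 (hγ i)) (G.inv_mem ((hf j).2.1 (hγ j))))
        ?_ ?_
      · calc γ i * (γ j)⁻¹ * k * (γ i * (γ j)⁻¹)⁻¹
            = γ i * ((γ j)⁻¹ * k * γ j) * (γ i)⁻¹ := by group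
          _ = γ i * ((γ i)⁻¹ * k * γ i) * (γ i)⁻¹ := by rw [heq]
          _ = k := by group
      · have := Subgroup.mem_centralizer_singleton_iff.1 (hfr i j hij (hγ j))
        calc γ i * (γ j)⁻¹ * (f i).1 * (γ i * (γ j)⁻¹)⁻¹
            = γ i * (γ j)⁻¹ * ((f i).1 * γ j) * (γ i)⁻¹ := by group
          _ = γ i * (γ j)⁻¹ * (γ j * (f i).1) * (γ i)⁻¹ := by rw [this]
          _ = γ i * (f i).1 * (γ i)⁻¹ := by group
    have hinj : Function.Injective fun i : Fin (n + 1) => (γ i)⁻¹ * k * γ i := by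
      intro i j hij
      rcases lt_trichotomy i j with h | h | h
      · exact absurd hij (hlt i j h)
      · exact h
      · exact absurd hij.symm (hlt j i h)
    have hsub : Set.range (fun i : Fin (n + 1) => (γ i)⁻¹ * k * γ i) ⊆ classIn G k := by
      rintro _ ⟨i, rfl⟩
      exact ⟨(γ i)⁻¹, G.inv_mem ((hf i).2.1 (hγ i)), by simp⟩
    have h1 := (Set.encard_le_encard hsub).trans (hGn k hk)
    rw [← Set.image_univ, hinj.encard_image, Set.encard_univ] at h1
    simp only [ENat.card_eq_coe_fintype_card, Fintype.card_fin, Nat.cast_le] at h1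
    omega
  obtain ⟨i, hi, hπ⟩ := key
  have hsub : (fun x => x * k) '' classIn G (f i).1 ⊆ classIn G ((f i).1 * k) := by
    rintro _ ⟨x, hx, rfl⟩
    obtain ⟨π, hπG, h1, h2⟩ := hπ x hx
    refine ⟨π, hπG, ?_⟩
    calc π * ((f i).1 * k) * π⁻¹ = (π * (f i).1 * π⁻¹) * (π * k * π⁻¹) := by group
      _ = x * k := by rw [h1, h2]
  -- The translate by k of the class of u_i already has the maximal size n, so it is the whole class
  -- of u_i k. Thus g u_i k g⁻¹ = x k with x conjugate to u_i, and g k g⁻¹ k⁻¹ = (g u_i g⁻¹)⁻¹ x.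
  have heq := (hfin _ (K.mul_mem (hf i).1 hk)).eq_of_subset_of_encard_le' hsub (by
    rw [(mul_left_injective k).encard_image]
    refine (hGn _ (K.mul_mem (hf i).1 hk)).trans ?_
    rw [← hclass]
    exact (hf i).2.2)
  have hmem : g * ((f i).1 * k) * g⁻¹ ∈ classIn G ((f i).1 * k) := ⟨g, hg, rfl⟩
  rw [← heq] at hmem
  obtain ⟨x, hx, hxk⟩ := hmem
  refine Set.mem_biUnion hi ⟨g * (f i).1 * g⁻¹, ⟨g, hg, rfl⟩, x, hx, ?_⟩
  have : x = g * ((f i).1 * k) * g⁻¹ * k⁻¹ := by rw [← hxk]; group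
  simp only [this]
  group

end BFC

/-! ### Finiteness of the commutator subgroups [K, K] and [L, K] -/

section MixedCommutator

open scoped commutatorElement

variable {H : Type*} [Group H]

/-- Take L generated by K and the normal core of G. An element of L is t g with g in the core and t
one of finitely many representatives in K, and [t g, k] = t [g, k] t⁻¹ · t (k t⁻¹ k⁻¹), where each
factor ranges over a finite set. -/
theorem IsBFCInside.exists_normal_finite_commutators {K : Subgroup H} [K.Normal]
    (hK : IsBFCInside K) :
    ∃ L : Subgroup H, L.Normal ∧ L.FiniteIndex ∧ K ≤ L ∧
      {x | ∃ l ∈ L, ∃ k ∈ K, ⁅l, k⁆ = x}.Finite := by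
  classical
  obtain ⟨G, hG, D, hD, hGD⟩ := hK.exists_finite_commutators
  have hsec : ∀ q : H ⧸ G.normalCore, ∃ t ∈ K, ∀ k ∈ K, (k : H ⧸ G.normalCore) = q →
      t⁻¹ * k ∈ G.normalCore := by
    intro q
    by_cases h : ∃ k ∈ K, (k : H ⧸ G.normalCore) = q
    · obtain ⟨t, ht, rfl⟩ := h
      exact ⟨t, ht, fun k hk hq => QuotientGroup.eq.1 hq.symm⟩
    · exact ⟨1, K.one_mem, fun k hk hq => absurd ⟨k, hk, hq⟩ h⟩
  choose t htK ht using hsec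
  refine ⟨K ⊔ G.normalCore, inferInstance, Subgroup.finiteIndex_of_le le_sup_right, le_sup_left, ?_⟩
  refine Set.Finite.subset (s := ⋃ q : H ⧸ G.normalCore,
    Set.image2 (fun d c => t q * d * (t q)⁻¹ * (t q * c)) D (conjClass (t q)⁻¹))
    (Set.finite_iUnion fun q => hD.image2 _ (hK.finite_conjClass (K.inv_mem (htK q)))) ?_
  rintro _ ⟨l, hl, k, hk, rfl⟩
  obtain ⟨k₀, hk₀, h₀, hh₀, rfl⟩ := Subgroup.mem_sup_of_normal_right.1 hl
  have h1 := G.normalCore.mul_mem (ht _ k₀ hk₀ rfl) hh₀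
  set q : H ⧸ G.normalCore := QuotientGroup.mk k₀
  refine Set.mem_iUnion.2 ⟨q, _, hGD _ (G.normalCore_le h1) k hk, k * (t q)⁻¹ * k⁻¹,
    ⟨k, rfl⟩, ?_⟩
  rw [commutatorElement_def]
  group

theorem IsBFCInside.finite_commutator {K : Subgroup H} [K.Normal] (hK : IsBFCInside K) :
    Finite (⁅K, K⁆ : Subgroup H) := by
  obtain ⟨L, -, -, hKL, hfin⟩ := hK.exists_normal_finite_commutators
  have : Finite (commutatorSet K) := by
    refine Set.Finite.of_finite_image (f := K.subtype) (hfin.subset ?_)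
      K.subtype_injective.injOn
    rintro _ ⟨_, ⟨a, b, rfl⟩, rfl⟩
    exact ⟨a, hKL a.2, b, b.2, rfl⟩
  rw [← Subgroup.map_subtype_commutator]
  have h : Finite (commutator K) := inferInstance
  have h2 : (commutator K : Set K).Finite := h
  exact h2.image K.subtype

/-- Modulo the finite group [K, K], the group [L, K] lies in an abelian group and is generated by
finitely many commutators, so it suffices that these be torsion. -/
theorem IsBFCInside.exists_finite_mixed_commutator {K : Subgroup H} [K.Normal]
    (hK : IsBFCInside K) :
    ∃ L : Subgroup H, L.Normal ∧ L.FiniteIndex ∧ K ≤ L ∧ Finite (⁅L, K⁆ : Subgroup H) := by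
  obtain ⟨L, hL, hLi, hKL, hfin⟩ := hK.exists_normal_finite_commutators
  refine ⟨L, hL, hLi, hKL, ?_⟩
  have hK' := hK.finite_commutator
  have hLK : ⁅L, K⁆ ≤ K := Subgroup.commutator_le_right L K
  let q := QuotientGroup.mk' ⁅K, K⁆
  have hcomm : ∀ a ∈ K, ∀ b ∈ K, Commute (q a) (q b) := by
    intro a ha b hb
    rw [← commutatorElement_eq_one_iff_commute, ← map_commutatorElement]
    exact (QuotientGroup.eq_one_iff _).2 (Subgroup.commutator_mem_commutator ha hb)
  -- Modulo [K, K], the n-th power of [l, k] is [l, k ^ n]. These take finitely many values, so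
  -- infinite order is excluded.
  have htors : ∀ l ∈ L, ∀ k ∈ K, IsOfFinOrder (q ⁅l, k⁆) := by
    intro l hl k hk
    by_contra hnot
    have hinj := injective_pow_iff_not_isOfFinOrder.2 hnot
    refine Set.infinite_range_of_injective hinj ((hfin.image q).subset ?_)
    rintro _ ⟨n, rfl⟩
    refine ⟨⁅l, k ^ n⁆, ⟨l, hl, k ^ n, K.pow_mem hk n, rfl⟩, ?_⟩
    have hc : Commute (q (l * k * l⁻¹)) (q k⁻¹) :=
      hcomm _ (Subgroup.Normal.conj_mem inferInstance k hk l) _ (K.inv_mem hk)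
    simp only [commutatorElement_def]
    rw [map_mul q (l * k * l⁻¹) k⁻¹, hc.mul_pow, ← map_pow, ← map_pow, ← map_mul, conj_pow,
      inv_pow]
  have htorsF : ∀ x ∈ ⁅L, K⁆, IsOfFinOrder (q x) := by
    intro x hx
    rw [Subgroup.commutator_def] at hx
    refine (Subgroup.closure_induction (p := fun x _ => IsOfFinOrder (q x) ∧ x ∈ K)
      ?_ ?_ ?_ ?_ hx).1
    · rintro _ ⟨l, hl, k, hk, rfl⟩
      exact ⟨htors l hl k hk, hLK (Subgroup.commutator_mem_commutator hl hk)⟩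
    · exact ⟨by simp, K.one_mem⟩
    · rintro x y - - ⟨hx, hxK⟩ ⟨hy, hyK⟩
      rw [map_mul]
      exact ⟨(hcomm x hxK y hyK).isOfFinOrder_mul hx hy, K.mul_mem hxK hyK⟩
    · rintro x - ⟨hx, hxK⟩
      rw [map_inv]
      exact ⟨hx.inv, K.inv_mem hxK⟩
  have hfg : Group.FG (⁅L, K⁆.map q) := by
    have hq : ⁅L, K⁆.map q = Subgroup.closure (q '' {x | ∃ l ∈ L, ∃ k ∈ K, ⁅l, k⁆ = x}) := by
      rw [← MonoidHom.map_closure, Subgroup.commutator_def L K]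
    rw [hq]
    have : Finite (q '' {x | ∃ l ∈ L, ∃ k ∈ K, ⁅l, k⁆ = x}) := (hfin.image q)
    exact Group.closure_finite_fg _
  have hmap : Finite (⁅L, K⁆.map q) := by
    let _ : CommGroup (⁅L, K⁆.map q) :=
      { (inferInstance : Group (⁅L, K⁆.map q)) with
        mul_comm := by
          rintro ⟨_, x, hx, rfl⟩ ⟨_, y, hy, rfl⟩
          exact Subtype.ext (hcomm x (hLK hx) y (hLK hy)) }
    refine CommGroup.finite_of_fg_isMulTorsion _ ?_
    rintro ⟨_, x, hx, rfl⟩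
    exact Submonoid.isOfFinOrder_coe.1 (htorsF x hx)
  have hker : Finite (q.domRestrict ⁅L, K⁆).ker := by
    refine Finite.of_injective (β := (⁅K, K⁆ : Subgroup H))
      (fun x => ⟨x.1.1, (QuotientGroup.eq_one_iff _).1 x.2⟩) ?_
    intro x y hxy
    exact Subtype.ext (Subtype.ext (Subtype.mk.inj hxy))
  refine (MonoidHom.finite_iff_finite_ker_range (q.domRestrict ⁅L, K⁆)).2 ⟨hker, ?_⟩
  rwa [MonoidHom.domRestrict_range]

end MixedCommutator

/-! ### Operators on `ℓ²(H)` and their matrix coefficients -/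

section L2

variable {H : Type*}

open scoped InnerProductSpace

/-- The standard basis vector of `ℓ²(H)` at `g`. -/
noncomputable def delta (g : H) : lp (fun _ : H => ℂ) 2 :=
  letI := Classical.decEq H
  lp.single 2 g (1 : ℂ)

theorem delta_apply_self (g : H) : delta g g = 1 := by
  simp [delta]

theorem delta_apply_ne {g h : H} (hgh : h ≠ g) : delta g h = 0 := by
  classical
  exact lp.single_apply_ne 2 g 1 hgh

theorem inner_delta_left (g : H) (f : lp (fun _ : H => ℂ) 2) : ⟪delta g, f⟫_ℂ = f g := by
  classical
  refine (lp.inner_single_left g 1 f).trans ?_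
  simp

theorem norm_delta (g : H) : ‖delta g‖ = 1 := by
  classical
  have h := lp.norm_single (E := fun _ : H => ℂ) (p := 2) (by norm_num) g 1
  rw [norm_one] at h
  exact h

theorem dense_span_delta : Dense (Submodule.span ℂ (Set.range (delta : H → _)) :
    Set (lp (fun _ : H => ℂ) 2)) := by
  rw [Submodule.dense_iff_topologicalClosure_eq_top, 
    Submodule.topologicalClosure_eq_top_iff]
  refine (Submodule.eq_bot_iff _).2 fun f hf => ?_
  ext g
  rw [← inner_delta_left]
  exact (Submodule.mem_orthogonal _ _).1 hf _ (Submodule.subset_span ⟨g, rfl⟩)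

/-- The matrix coefficient of an operator on `ℓ²(H)`. -/
noncomputable def coef (x : lp (fun _ : H => ℂ) 2 →L[ℂ] lp (fun _ : H => ℂ) 2) (h g : H) : ℂ :=
  x (delta g) h

variable {x y : lp (fun _ : H => ℂ) 2 →L[ℂ] lp (fun _ : H => ℂ) 2}

theorem inner_delta_apply_delta (h g : H) : ⟪delta h, x (delta g)⟫_ℂ = coef x h g :=
  inner_delta_left h _

theorem eq_of_delta (hxy : ∀ g, x (delta g) = y (delta g)) : x = y :=
  ContinuousLinearMap.ext_on dense_span_delta (by rintro _ ⟨g, rfl⟩; exact hxy g)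

theorem eq_of_coef (hxy : ∀ h g, coef x h g = coef y h g) : x = y :=
  eq_of_delta fun g => by ext h; exact hxy h g

theorem coef_star (h g : H) : coef (star x) h g = star (coef x g h) := by
  rw [← inner_delta_apply_delta, ← inner_delta_apply_delta, ContinuousLinearMap.star_eq_adjoint,
    ContinuousLinearMap.adjoint_inner_right]
  exact (inner_conj_symm _ _).symm

theorem coef_add (h g : H) : coef (x + y) h g = coef x h g + coef y h g := rfl

theorem coef_smul (c : ℂ) (h g : H) : coef (c • x) h g = c * coef x h g := rfl

theorem coef_sum {ι : Type*} (s : Finset ι)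
    (x : ι → lp (fun _ : H => ℂ) 2 →L[ℂ] lp (fun _ : H => ℂ) 2) (h g : H) :
    coef (∑ i ∈ s, x i) h g = ∑ i ∈ s, coef (x i) h g := by
  classical
  induction s using Finset.induction_on with
  | empty => rfl
  | insert a s ha ih => rw [Finset.sum_insert ha, Finset.sum_insert ha, coef_add, ih]

theorem hasSum_coef_mul (h g : H) :
    HasSum (fun m => coef x h m * coef y m g) (coef (x * y) h g) := by
  have h1 := lp.hasSum_inner (𝕜 := ℂ) (star x (delta h)) (y (delta g))
  rw [ContinuousLinearMap.star_eq_adjoint, ContinuousLinearMap.adjoint_inner_left,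
    ← mul_apply_eq_comp, inner_delta_apply_delta] at h1
  refine h1.congr_fun ?_
  intro m
  have h2 : ContinuousLinearMap.adjoint x (delta h) m = star (coef x h m) := coef_star m h
  rw [h2, RCLike.inner_apply]
  simp [coef, mul_comm]

/-- Multiplication by the indicator function of a set. -/
noncomputable def indicatorOp (T : Set H) : lp (fun _ : H => ℂ) 2 →L[ℂ] lp (fun _ : H => ℂ) 2 :=
  have key : ∀ (f : lp (fun _ : H => ℂ) 2) (x : H),
      ‖T.indicator f x‖ ^ (2 : ENNReal).toReal ≤ ‖f x‖ ^ (2 : ENNReal).toReal := by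
    intro f x
    gcongr
    exact norm_indicator_le_norm_self f x
  have hmem : ∀ f : lp (fun _ : H => ℂ) 2, Memℓp (T.indicator f) 2 := fun f =>
    (memℓp_gen_iff (by norm_num)).2 (Summable.of_nonneg_of_le (fun _ => by positivity) (key f)
      ((memℓp_gen_iff (by norm_num)).1 f.2))
  LinearMap.mkContinuous
    { toFun := fun f => ⟨T.indicator f, hmem f⟩
      map_add' := fun f g => Subtype.ext (Set.indicator_add T f g)
      map_smul' := fun c f => Subtype.ext (Set.indicator_const_smul T c f) } 1 (by
      intro f
      rw [one_mul, lp.norm_eq_tsum_rpow (by norm_num), lp.norm_eq_tsum_rpow (by norm_num)]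
      refine Real.rpow_le_rpow (tsum_nonneg fun _ => by positivity) ?_ (by norm_num)
      exact Summable.tsum_le_tsum (key f) ((memℓp_gen_iff (by norm_num)).1 (hmem f))
        ((memℓp_gen_iff (by norm_num)).1 f.2))

theorem indicatorOp_apply (T : Set H) (f : lp (fun _ : H => ℂ) 2) (x : H) :
    indicatorOp T f x = T.indicator f x := rfl

theorem indicatorOp_delta_of_mem {T : Set H} {g : H} (hg : g ∈ T) :
    indicatorOp T (delta g) = delta g := by
  ext h
  rw [indicatorOp_apply]
  by_cases hh : h = g
  · subst hh; exact Set.indicator_of_mem hg _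
  · rw [delta_apply_ne hh, Set.indicator_apply_eq_zero]
    exact fun _ => delta_apply_ne hh

theorem indicatorOp_delta_of_notMem {T : Set H} {g : H} (hg : g ∉ T) :
    indicatorOp T (delta g) = 0 := by
  ext h
  rw [indicatorOp_apply, lp.coeFn_zero, Pi.zero_apply, Set.indicator_apply_eq_zero]
  rintro hh
  exact delta_apply_ne (by rintro rfl; exact hg hh)

theorem star_indicatorOp (T : Set H) : star (indicatorOp T) = indicatorOp T := by
  classical
  refine eq_of_coef fun h g => ?_
  rw [coef_star]
  by_cases hh : h ∈ T <;> by_cases hg : g ∈ T <;> by_cases hgh : g = h <;>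
    simp_all [coef, indicatorOp_apply, delta_apply_self, delta_apply_ne, Set.indicator, ne_comm]

theorem coef_indicatorOp_mul_mul (T : Set H) (h g : H) [Decidable (h ∈ T)] [Decidable (g ∈ T)] :
    coef (indicatorOp T * x * indicatorOp T) h g = if h ∈ T ∧ g ∈ T then coef x h g else 0 := by
  rw [coef, mul_apply_eq_comp, mul_apply_eq_comp]
  by_cases hg : g ∈ T
  · rw [indicatorOp_delta_of_mem hg, indicatorOp_apply]
    by_cases hh : h ∈ T <;> simp [hh, hg, coef]
  · rw [indicatorOp_delta_of_notMem hg, map_zero, map_zero]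
    simp [hg]

end L2

/-! ### Translations, coefficients of `L(S)`, and the center of `L(H)` -/

section Translation

variable {H : Type*} [Group H]

open scoped InnerProductSpace

/-- The right translation `(ρ_g f)(x) = f (x g)` on `ℓ²(H)`. -/
noncomputable def rightTranslation (g : H) :
    lp (fun _ : H => ℂ) 2 →L[ℂ] lp (fun _ : H => ℂ) 2 :=
  LinearMap.mkContinuous
    { toFun := fun f => ⟨fun x => f (x * g), by
        have hf := (memℓp_gen_iff (by norm_num)).1 f.2
        exact (memℓp_gen_iff (by norm_num)).2 ((Equiv.mulRight g).summable_iff.2 hf)⟩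
      map_add' := fun _ _ => rfl
      map_smul' := fun _ _ => rfl } 1 (by
      intro f
      rw [one_mul, lp.norm_eq_tsum_rpow (by norm_num), lp.norm_eq_tsum_rpow (by norm_num)]
      apply le_of_eq
      congr 1
      exact (Equiv.mulRight g).tsum_eq fun x => ‖f x‖ ^ (2 : ENNReal).toReal)

theorem leftTranslation_apply (g : H) (f : lp (fun _ : H => ℂ) 2) (x : H) :
    leftTranslation g f x = f (g⁻¹ * x) := rfl

theorem rightTranslation_apply (g : H) (f : lp (fun _ : H => ℂ) 2) (x : H) :
    rightTranslation g f x = f (x * g) := rfl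

theorem leftTranslation_delta (g h : H) : leftTranslation g (delta h) = delta (g * h) := by
  ext x
  rw [leftTranslation_apply]
  by_cases hx : x = g * h
  · subst hx; rw [inv_mul_cancel_left, delta_apply_self, delta_apply_self]
  · rw [delta_apply_ne hx, delta_apply_ne]
    rintro rfl; exact hx (by group)

theorem rightTranslation_delta (g h : H) : rightTranslation g (delta h) = delta (h * g⁻¹) := by
  ext x
  rw [rightTranslation_apply]
  by_cases hx : x = h * g⁻¹
  · subst hx; rw [inv_mul_cancel_right, delta_apply_self, delta_apply_self]
  · rw [delta_apply_ne hx, delta_apply_ne]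
    rintro rfl; exact hx (by group)

theorem leftTranslation_mul (g h : H) :
    leftTranslation (g * h) = leftTranslation g * leftTranslation h :=
  eq_of_delta fun k => by
    rw [mul_apply_eq_comp, leftTranslation_delta, leftTranslation_delta,
      leftTranslation_delta, mul_assoc]

theorem star_leftTranslation (g : H) : star (leftTranslation g) = leftTranslation g⁻¹ := by
  refine eq_of_coef fun h k => ?_
  rw [coef_star]
  simp only [coef, leftTranslation_delta]
  by_cases hk : k = g * h
  · subst hk; rw [inv_mul_cancel_left, delta_apply_self, delta_apply_self, star_one]
  · rw [delta_apply_ne hk, delta_apply_ne, star_zero]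
    rintro rfl; exact hk (by group)

theorem norm_rightTranslation_apply (g : H) (f : lp (fun _ : H => ℂ) 2) :
    ‖rightTranslation g f‖ = ‖f‖ := by
  rw [lp.norm_eq_tsum_rpow (by norm_num), lp.norm_eq_tsum_rpow (by norm_num)]
  congr 1
  exact (Equiv.mulRight g).tsum_eq fun x => ‖f x‖ ^ (2 : ENNReal).toReal

theorem norm_leftTranslation_apply (g : H) (f : lp (fun _ : H => ℂ) 2) :
    ‖leftTranslation g f‖ = ‖f‖ := by
  rw [lp.norm_eq_tsum_rpow (by norm_num), lp.norm_eq_tsum_rpow (by norm_num)]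
  congr 1
  exact (Equiv.mulLeft g⁻¹).tsum_eq fun x => ‖f x‖ ^ (2 : ENNReal).toReal

variable {x y : lp (fun _ : H => ℂ) 2 →L[ℂ] lp (fun _ : H => ℂ) 2}

theorem coef_leftTranslation_mul (k h g : H) :
    coef (leftTranslation k * x) h g = coef x (k⁻¹ * h) g := rfl

theorem coef_mul_leftTranslation (k h g : H) :
    coef (x * leftTranslation k) h g = coef x h (k * g) := by
  simp only [coef, mul_apply_eq_comp, leftTranslation_delta]

theorem coef_rightTranslation_mul (k h g : H) :
    coef (rightTranslation k * x) h g = coef x (h * k) g := rfl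

theorem coef_mul_rightTranslation (k h g : H) :
    coef (x * rightTranslation k) h g = coef x h (g * k⁻¹) := by
  simp only [coef, mul_apply_eq_comp, rightTranslation_delta]

theorem leftTranslation_mem_groupVN {S : Subgroup H} {s : H} (hs : s ∈ S) :
    leftTranslation s ∈ groupVN S :=
  (StarSubalgebra.mem_centralizer_iff ℂ).2 fun y hy => by
    have h1 := ((StarSubalgebra.mem_centralizer_iff ℂ).1 hy _ ⟨s, hs, rfl⟩).1
    have h2 := ((StarSubalgebra.mem_centralizer_iff ℂ).1 (star_mem hy) _ ⟨s, hs, rfl⟩).1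
    exact ⟨h1.symm, h2.symm⟩

theorem commute_of_mem_groupVN {S : Subgroup H} (hx : x ∈ groupVN S)
    (hy : ∀ s ∈ S, leftTranslation s * y = y * leftTranslation s) : x * y = y * x := by
  refine ((StarSubalgebra.mem_centralizer_iff ℂ).1 hx y ?_).1.symm
  refine (StarSubalgebra.mem_centralizer_iff ℂ).2 ?_
  rintro _ ⟨s, hs, rfl⟩
  rw [star_leftTranslation]
  exact ⟨hy s hs, hy _ (S.inv_mem hs)⟩

/-- Right translations commute with left ones, hence with every element of `L(S)`. -/
theorem coef_eq_of_mem_groupVN {S : Subgroup H} (hx : x ∈ groupVN S) (h g : H) :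
    coef x h g = coef x (h * g⁻¹) 1 := by
  have h1 := commute_of_mem_groupVN (y := rightTranslation g) hx fun s _ => by
    refine eq_of_coef fun h k => ?_
    rw [coef_leftTranslation_mul, coef_mul_leftTranslation]
    simp only [coef, rightTranslation_delta]
    by_cases hk : h = s * k * g⁻¹
    · subst hk
      rw [delta_apply_self, show s⁻¹ * (s * k * g⁻¹) = k * g⁻¹ by group, delta_apply_self]
    · rw [delta_apply_ne hk, delta_apply_ne]
      intro h'
      exact hk (by rw [mul_assoc, ← h', mul_inv_cancel_left])
  have h2 := congrArg (fun z => coef z (h * g⁻¹) g) h1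
  simp only [coef_rightTranslation_mul, coef_mul_rightTranslation] at h2
  rw [inv_mul_cancel_right, mul_inv_cancel] at h2
  exact h2.symm

/-- Left translation by S preserves S, so restriction of functions to S commutes with `L(S)`, and x
δ_1 stays supported on S. -/
theorem coef_eq_zero_of_mem_groupVN {S : Subgroup H} (hx : x ∈ groupVN S) {h : H} (hh : h ∉ S) :
    coef x h 1 = 0 := by
  have h1 := commute_of_mem_groupVN (y := indicatorOp (S : Set H)) hx fun s hs => by
    refine eq_of_coef fun h k => ?_
    rw [coef_leftTranslation_mul, coef_mul_leftTranslation]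
    simp only [coef]
    by_cases hk : k ∈ S
    · rw [indicatorOp_delta_of_mem (by exact hk),
        indicatorOp_delta_of_mem (by exact S.mul_mem hs hk), ← leftTranslation_delta]
      rfl
    · rw [indicatorOp_delta_of_notMem (by exact hk),
        indicatorOp_delta_of_notMem (by exact fun h' => hk ((S.mul_mem_cancel_left hs).1 h'))]
      rfl
  have h2 := congrArg (fun z => coef z h 1) h1
  simp only [coef, mul_apply_eq_comp] at h2
  rw [indicatorOp_delta_of_mem (by exact S.one_mem), indicatorOp_apply] at h2
  rw [coef, h2]
  exact Set.indicator_of_notMem hh _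

/-- The group von Neumann algebra of `S` consists of the operators whose matrix coefficients are
invariant under right translations and which are supported on `S`. -/
theorem mem_groupVN_iff {S : Subgroup H} :
    x ∈ groupVN S ↔ (∀ h g, coef x h g = coef x (h * g⁻¹) 1) ∧ ∀ h ∉ S, coef x h 1 = 0 := by
  refine ⟨fun hx => ⟨coef_eq_of_mem_groupVN hx, fun h hh => coef_eq_zero_of_mem_groupVN hx hh⟩, ?_⟩
  rintro ⟨hx, hS⟩
  have key : ∀ y : lp (fun _ : H => ℂ) 2 →L[ℂ] lp (fun _ : H => ℂ) 2,
      (∀ s ∈ S, leftTranslation s * y = y * leftTranslation s) → y * x = x * y := by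
    intro y hy
    refine eq_of_coef fun h g => ?_
    -- The two matrix product series are reindexed by m = k g and m = k⁻¹ h, so that both carry the
    -- coefficient of x at k. Only k in S contributes, and there y commutes with u_k.
    have h1 := (Equiv.mulRight g).hasSum_iff.2 (hasSum_coef_mul (x := y) (y := x) h g)
    have h2 := ((Equiv.inv H).trans (Equiv.mulRight h)).hasSum_iff.2
      (hasSum_coef_mul (x := x) (y := y) h g)
    refine h1.unique (h2.congr_fun fun k => ?_)
    simp only [Function.comp_apply, Equiv.coe_mulRight, Equiv.trans_apply, Equiv.inv_apply]
    rw [hx (k * g) g, hx h (k⁻¹ * h), mul_inv_cancel_right,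
      show h * (k⁻¹ * h)⁻¹ = k by group]
    by_cases hk : k ∈ S
    · have h3 := congrArg (fun z => coef z h g) (hy k hk)
      simp only [coef_leftTranslation_mul, coef_mul_leftTranslation] at h3
      rw [h3, mul_comm]
    · rw [hS k hk, zero_mul, mul_zero]
  refine (StarSubalgebra.mem_centralizer_iff ℂ).2 fun y hy => ⟨key y fun s hs => ?_,
    key (star y) fun s hs => ?_⟩
  · exact ((StarSubalgebra.mem_centralizer_iff ℂ).1 hy _ ⟨s, hs, rfl⟩).1
  · exact ((StarSubalgebra.mem_centralizer_iff ℂ).1 (star_mem hy) _ ⟨s, hs, rfl⟩).1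

theorem groupVN_mono {S T : Subgroup H} (hST : S ≤ T) (hx : x ∈ groupVN S) : x ∈ groupVN T := by
  rw [mem_groupVN_iff] at hx ⊢
  exact ⟨hx.1, fun h hh => hx.2 h fun h' => hh (hST h')⟩

theorem mem_groupVN_top_iff :
    x ∈ groupVN (⊤ : Subgroup H) ↔ ∀ h g, coef x h g = coef x (h * g⁻¹) 1 := by
  simp [mem_groupVN_iff]

theorem mem_vnCenter_groupVN_iff :
    x ∈ vnCenter (groupVN (⊤ : Subgroup H)) ↔
      x ∈ groupVN (⊤ : Subgroup H) ∧ ∀ h g, coef x (h * g * h⁻¹) 1 = coef x g 1 := by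
  have hmem : x ∈ vnCenter (groupVN (⊤ : Subgroup H)) ↔
      x ∈ groupVN (⊤ : Subgroup H) ∧ x ∈ (groupVN (⊤ : Subgroup H)).commutant := Iff.rfl
  rw [hmem, VonNeumannAlgebra.mem_commutant_iff]
  refine and_congr_right fun hx => ?_
  have hx' := mem_groupVN_top_iff.1 hx
  constructor
  · intro h h' g
    have := congrArg (fun z => coef z (h' * g) 1)
      (h _ (leftTranslation_mem_groupVN (Subgroup.mem_top h')))
    simp only [coef_leftTranslation_mul, coef_mul_leftTranslation] at this
    rw [inv_mul_cancel_left, hx' _ (h' * 1), mul_one] at this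
    exact this.symm
  · intro h y hy
    refine commute_of_mem_groupVN hy fun s _ => eq_of_coef fun k g => ?_
    rw [coef_leftTranslation_mul, coef_mul_leftTranslation, hx', hx' k, ← h s]
    group

/-- Elements of the center of the group von Neumann algebra decay along large conjugacy
classes. -/
theorem encard_mul_le_of_mem_vnCenter (hx : x ∈ vnCenter (groupVN (⊤ : Subgroup H))) (g : H)
    {n : ℕ} (hn : n ≤ (conjClass g).encard) : n * ‖coef x g 1‖ ^ 2 ≤ ‖x‖ ^ 2 := by
  obtain ⟨t, ht, htn⟩ := Set.exists_subset_encard_eq hn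
  have htf : t.Finite := Set.finite_of_encard_eq_coe htn
  have h1 := lp.sum_rpow_le_norm_rpow (p := 2) (by norm_num) (x (delta 1)) htf.toFinset
  have h2 : ∀ i ∈ htf.toFinset, ‖x (delta 1) i‖ ^ (2 : ENNReal).toReal = ‖coef x g 1‖ ^ 2 := by
    intro i hi
    obtain ⟨h, rfl⟩ := ht (htf.mem_toFinset.1 hi)
    have := (mem_vnCenter_groupVN_iff.1 hx).2 h g
    rw [coef] at this
    rw [this]
    norm_num
  rw [Finset.sum_congr rfl h2, Finset.sum_const, nsmul_eq_mul] at h1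
  have h3 : htf.toFinset.card = n := by
    have := htf.encard_eq_coe_toFinset_card
    rw [htn] at this
    exact_mod_cast this.symm
  rw [h3] at h1
  refine h1.trans ?_
  have h4 : ‖x (delta 1)‖ ≤ ‖x‖ := by simpa [norm_delta] using x.le_opNorm (delta 1)
  norm_num
  gcongr

theorem coef_eq_zero_of_mem_vnCenter (hx : x ∈ vnCenter (groupVN (⊤ : Subgroup H))) {g : H}
    (hg : g ∉ fcCenter H) : coef x g 1 = 0 := by
  have hinf : (conjClass g).encard = ⊤ := Set.encard_eq_top_iff.2 hg
  by_contra hne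
  have hpos : 0 < ‖coef x g 1‖ ^ 2 := by positivity
  obtain ⟨n, hn⟩ := exists_nat_gt (‖x‖ ^ 2 / ‖coef x g 1‖ ^ 2)
  have := encard_mul_le_of_mem_vnCenter hx g (n := n) (by rw [hinf]; exact le_top)
  rw [div_lt_iff₀ hpos] at hn
  linarith

end Translation

/-! ### Intertwining into the center forces bounded conjugacy classes -/

section Corner

variable {E : Type*} [NormedAddCommGroup E] [InnerProductSpace ℂ E] [CompleteSpace E]

theorem isClosed_vonNeumannAlgebra (N : VonNeumannAlgebra E) : IsClosed (N : Set (E →L[ℂ] E)) := by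
  rw [← VonNeumannAlgebra.centralizer_centralizer]
  exact Set.isClosed_centralizer _

theorem isClosed_vnCorner (N : VonNeumannAlgebra E) {p : E →L[ℂ] E} (hp : IsStarProjection p)
    (hpN : p ∈ N) : IsClosed (vnCorner N p hp hpN : Set (E →L[ℂ] E)) := by
  have h : (vnCorner N p hp hpN : Set (E →L[ℂ] E)) = (N : Set (E →L[ℂ] E)) ∩ {x | p * x * p = x} := by
    ext x
    constructor
    · rintro ⟨y, hy, rfl⟩
      refine ⟨mul_mem (mul_mem hpN hy) hpN, ?_⟩
      have hpp : p * p = p := hp.isIdempotentElem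
      change p * (p * y * p) * p = p * y * p
      rw [← mul_assoc, ← mul_assoc, hpp, mul_assoc, hpp]
    · rintro ⟨hx, hxp⟩
      exact ⟨x, hx, hxp⟩
  rw [h]
  exact (isClosed_vonNeumannAlgebra N).inter (isClosed_eq (by fun_prop) continuous_id)

/-- Corners are norm closed, hence C*-algebras, on which *-homomorphisms are automatically
contractive. -/
theorem norm_vnCorner_hom_le {N₁ N₂ : VonNeumannAlgebra E} {p q : E →L[ℂ] E}
    {hp : IsStarProjection p} {hq : IsStarProjection q} {hpN : p ∈ N₁} {hqN : q ∈ N₂}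
    (Θ : vnCorner N₁ p hp hpN →⋆ₙₐ[ℂ] vnCorner N₂ q hq hqN) (x : vnCorner N₁ p hp hpN) :
    ‖Θ x‖ ≤ ‖x‖ := by
  let _ : NonUnitalCStarAlgebra (vnCorner N₁ p hp hpN) :=
    NonUnitalStarSubalgebra.nonUnitalCStarAlgebra _ (h_closed := isClosed_vnCorner N₁ hp hpN)
  let _ : NonUnitalCStarAlgebra (vnCorner N₂ q hq hqN) :=
    NonUnitalStarSubalgebra.nonUnitalCStarAlgebra _ (h_closed := isClosed_vnCorner N₂ hq hqN)
  exact NonUnitalStarAlgHom.norm_apply_le Θ x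

theorem mem_of_mem_vnCenter {M : VonNeumannAlgebra E} {z : E →L[ℂ] E} (hz : z ∈ vnCenter M) :
    z ∈ M := hz.1

theorem mul_comm_of_mem_vnCenter {M : VonNeumannAlgebra E} {z y : E →L[ℂ] E}
    (hz : z ∈ vnCenter M) (hy : y ∈ M) : y * z = z * y :=
  VonNeumannAlgebra.mem_commutant_iff.1 hz.2 y hy

/-- Intertwining into the center: on a nonzero projection `e`, the corner `p N p` acts by central
operators. -/
theorem Intertwines.exists_projection {M N : VonNeumannAlgebra E} (hNM : ∀ x ∈ N, x ∈ M)
    (h : Intertwines M N (vnCenter M)) :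
    ∃ p e : E →L[ℂ] E, p ∈ N ∧ star p = p ∧ e ∈ M ∧ e ≠ 0 ∧ star e = e ∧ e * e = e ∧
      p * e = e ∧ e * p = e ∧ ‖e‖ ≤ 1 ∧
      ∀ y ∈ N, ‖y‖ ≤ 1 → ∃ z ∈ vnCenter M, ‖z‖ ≤ 1 ∧ e * y * p = z * e ∧ p * y * e = z * e := by
  obtain ⟨p, q, hp, hq, hpN, hqA, -, -, Θ, v, ⟨y₀, hy₀, hv⟩, hvv, hv0, hΘ⟩ := h
  have hpp : p * p = p := hp.isIdempotentElem
  have hps : star p = p := hp.isSelfAdjoint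
  have hvM : v ∈ M := hv ▸ mul_mem (mul_mem (mem_of_mem_vnCenter hqA) hy₀) (hNM p hpN)
  have hvp : v * p = v := by rw [← hv, mul_assoc, hpp]
  have hpv : p * star v = star v := by
    have := congrArg star hvp
    rwa [star_mul, hps] at this
  have hes : star (star v * v) = star v * v := by rw [star_mul, star_star]
  have hee : star v * v * (star v * v) = star v * v := by
    rw [mul_assoc, ← mul_assoc v, hvv]
  have heproj : IsStarProjection (star v * v) := ⟨hee, hes⟩
  -- The projection is e = v*v, and the central operator attached to y will be Θ(p y p). Since Θ has
  -- central values, e x = v* Θ(x) v = Θ(x) e; taking adjoints gives x e = Θ(x) e.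
  refine ⟨p, star v * v, hpN, hps, mul_mem (star_mem hvM) hvM, ?_, hes, hee, ?_, ?_,
    heproj.norm_le, ?_⟩
  · intro h0
    apply hv0
    rw [← hvv, mul_assoc, h0, mul_zero]
  · rw [← mul_assoc, hpv]
  · rw [mul_assoc, hvp]
  have hpn : ‖p‖ ≤ 1 := hp.norm_le
  have hcorner : ∀ y ∈ N, p * y * p ∈ vnCorner N p hp hpN := fun y hy => ⟨y, hy, rfl⟩
  have hΘA : ∀ x : vnCorner N p hp hpN, (Θ x : E →L[ℂ] E) ∈ vnCenter M := by
    intro x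
    obtain ⟨a, ha, hax⟩ := (Θ x).2
    rw [← hax]
    exact mul_mem (mul_mem hqA ha) hqA
  have hex : ∀ x : vnCorner N p hp hpN, star v * v * (x : E →L[ℂ] E) = Θ x * (star v * v) := by
    intro x
    rw [mul_assoc, ← hΘ x, ← mul_assoc, ← mul_assoc,
      mul_comm_of_mem_vnCenter (hΘA x) (star_mem hvM)]
  have hxe : ∀ x : vnCorner N p hp hpN, (x : E →L[ℂ] E) * (star v * v) = Θ x * (star v * v) := by
    intro x
    have h1 := congrArg star (hex (star x))
    rw [star_mul, star_mul (Θ _ : E →L[ℂ] E), map_star, hes] at h1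
    have h2 : star ((star x : vnCorner N p hp hpN) : E →L[ℂ] E) = x := star_star (x : E →L[ℂ] E)
    have h3 : star ((star (Θ x) : vnCorner _ q hq hqA) : E →L[ℂ] E) = Θ x :=
      star_star (Θ x : E →L[ℂ] E)
    rw [h2, h3] at h1
    rw [h1, mul_comm_of_mem_vnCenter (hΘA x) (mul_mem (star_mem hvM) hvM)]
  intro y hy hy1
  refine ⟨Θ ⟨_, hcorner y hy⟩, hΘA _, (norm_vnCorner_hom_le Θ _).trans ?_, ?_, ?_⟩
  · change ‖p * y * p‖ ≤ 1
    calc ‖p * y * p‖ ≤ ‖p‖ * ‖y‖ * ‖p‖ := (norm_mul_le _ _).trans (by gcongr; exact norm_mul_le _ _)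
      _ ≤ 1 * 1 * 1 := by gcongr
      _ = 1 := by norm_num
  · rw [← hex]
    change star v * v * y * p = star v * v * (p * y * p)
    rw [← mul_assoc, ← mul_assoc, mul_assoc (star v) v p, hvp]
  · rw [← hxe]
    change p * y * (star v * v) = p * y * p * (star v * v)
    rw [mul_assoc (p * y) p, ← mul_assoc p (star v), hpv]

end Corner

/-! ### Convergence for equi-Lipschitz families -/

section Tendsto

open Filter Topology

theorem isClosed_setOf_tendsto_zero {ι E F : Type*} [SeminormedAddCommGroup E]
    [SeminormedAddCommGroup F] {l : Filter ι} {f : ι → E → F} {C : ℝ}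
    (hf : ∀ i x y, ‖f i x - f i y‖ ≤ C * ‖x - y‖) :
    IsClosed {x | Tendsto (fun i => f i x) l (𝓝 0)} := by
  refine isClosed_of_closure_subset fun x hx => ?_
  refine Metric.tendsto_nhds.2 fun ε hε => ?_
  obtain ⟨y, hy, hxy⟩ := Metric.mem_closure_iff.1 hx (ε / 2 / (|C| + 1)) (by positivity)
  filter_upwards [Metric.tendsto_nhds.1 hy (ε / 2) (by positivity)] with i hi
  rw [dist_zero_right] at hi ⊢
  rw [dist_eq_norm, lt_div_iff₀ (by positivity)] at hxy
  have h1 := hf i x y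
  have h2 : C * ‖x - y‖ ≤ |C| * ‖x - y‖ := by gcongr; exact le_abs_self C
  have h3 := norm_nonneg (x - y)
  have h4 : ‖f i x‖ ≤ ‖f i x - f i y‖ + ‖f i y‖ := norm_le_norm_sub_add _ _
  nlinarith

end Tendsto

/-! ### Strong decay along growing classes, and its group-theoretic consequences -/

section Intertwining

variable {H : Type*} [Group H]

open Filter Topology InnerProductSpace

/-- For basis vectors δ_h, δ_g the inner product is the coefficient of z_i at s_i h g⁻¹, which is
small because that class is large. Uniform boundedness extends this to all vectors, one variable at
a time. -/
theorem tendsto_inner_of_mem_vnCenter {ι : Type*} {l : Filter ι} {s : ι → H}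
    (hs : ∀ (k : H) (n : ℕ), ∀ᶠ i in l, n ≤ (conjClass (s i * k)).encard)
    {z : ι → lp (fun _ : H => ℂ) 2 →L[ℂ] lp (fun _ : H => ℂ) 2}
    (hz : ∀ i, z i ∈ vnCenter (groupVN (⊤ : Subgroup H))) (hz1 : ∀ i, ‖z i‖ ≤ 1)
    (ξ η : lp (fun _ : H => ℂ) 2) :
    Tendsto (fun i => ⟪leftTranslation (s i) ξ, z i η⟫_ℂ) l (𝓝 0) := by
  have hdelta : ∀ h g : H,
      Tendsto (fun i => ⟪leftTranslation (s i) (delta h), z i (delta g)⟫_ℂ) l (𝓝 0) := by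
    intro h g
    refine Metric.tendsto_nhds.2 fun ε hε => ?_
    obtain ⟨n, hn⟩ := exists_nat_gt (1 / ε ^ 2)
    filter_upwards [hs (h * g⁻¹) n] with i hi
    rw [dist_zero_right, leftTranslation_delta, inner_delta_apply_delta,
      mem_groupVN_top_iff.1 (mem_of_mem_vnCenter (hz i)), mul_assoc]
    have h1 := encard_mul_le_of_mem_vnCenter (hz i) _ hi
    have h2 : ‖z i‖ ^ 2 ≤ 1 := pow_le_one₀ (norm_nonneg _) (hz1 i)
    rw [div_lt_iff₀ (by positivity)] at hn
    by_contra! hle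
    have h3 : ε ^ 2 ≤ ‖coef (z i) (s i * (h * g⁻¹)) 1‖ ^ 2 := by gcongr
    have h4 : (n : ℝ) * ε ^ 2 ≤ n * ‖coef (z i) (s i * (h * g⁻¹)) 1‖ ^ 2 := by gcongr
    linarith
  have hbound : ∀ (i : ι) (ξ η : lp (fun _ : H => ℂ) 2),
      ‖⟪leftTranslation (s i) ξ, z i η⟫_ℂ‖ ≤ ‖ξ‖ * ‖η‖ := by
    intro i ξ η
    refine (norm_inner_le_norm _ _).trans ?_
    rw [norm_leftTranslation_apply]
    gcongr
    simpa using (z i).le_of_opNorm_le (hz1 i) η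
  have hright : ∀ (h : H) (η : lp (fun _ : H => ℂ) 2),
      Tendsto (fun i => ⟪leftTranslation (s i) (delta h), z i η⟫_ℂ) l (𝓝 0) := by
    intro h
    let V : Submodule ℂ (lp (fun _ : H => ℂ) 2) :=
      { carrier := {η | Tendsto (fun i => ⟪leftTranslation (s i) (delta h), z i η⟫_ℂ) l (𝓝 0)}
        zero_mem' := by simp [tendsto_const_nhds]
        add_mem' := fun ha hb => by
          simpa only [map_add, inner_add_right, add_zero, Set.mem_ofPred_eq] using ha.add hb
        smul_mem' := fun c a ha => by
          simpa only [map_smul, inner_smul_right, mul_zero, Set.mem_ofPred_eq] using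
            ha.const_mul c }
    have hV : IsClosed (V : Set (lp (fun _ : H => ℂ) 2)) :=
      isClosed_setOf_tendsto_zero (C := 1) fun i x y => by
        rw [← inner_sub_right, ← map_sub]
        refine (hbound i (delta h) (x - y)).trans ?_
        rw [norm_delta]
    have hle : Submodule.span ℂ (Set.range delta) ≤ V :=
      Submodule.span_le.2 (by rintro _ ⟨g, rfl⟩; exact hdelta h g)
    exact fun η => hV.closure_subset_iff.2 hle (dense_span_delta η)
  let V : Submodule ℂ (lp (fun _ : H => ℂ) 2) :=
    { carrier := {ξ | Tendsto (fun i => ⟪leftTranslation (s i) ξ, z i η⟫_ℂ) l (𝓝 0)}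
      zero_mem' := by simp [tendsto_const_nhds]
      add_mem' := fun ha hb => by
        simpa only [map_add, inner_add_left, add_zero, Set.mem_ofPred_eq] using ha.add hb
      smul_mem' := fun c a ha => by
        simpa only [map_smul, inner_smul_left, mul_zero, Set.mem_ofPred_eq] using
          ha.const_mul (starRingEnd ℂ c) }
  have hV : IsClosed (V : Set (lp (fun _ : H => ℂ) 2)) :=
    isClosed_setOf_tendsto_zero (C := ‖η‖) fun i x y => by
      rw [← inner_sub_left, ← map_sub, mul_comm]
      exact hbound i (x - y) η
  have hle : Submodule.span ℂ (Set.range delta) ≤ V :=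
    Submodule.span_le.2 (by rintro _ ⟨g, rfl⟩; exact hright g η)
  exact hV.closure_subset_iff.2 hle (dense_span_delta ξ)

theorem norm_leftTranslation_le (g : H) : ‖leftTranslation g‖ ≤ 1 :=
  ContinuousLinearMap.opNorm_le_bound _ zero_le_one fun f => by
    rw [norm_leftTranslation_apply, one_mul]

/-- A failure for every pair (E, C) gives a net in S, indexed by these pairs, along which e u_s
tends strongly to 0. Right invariance of ‖e δ_s‖ contradicts this. -/
theorem Intertwines.exists_finset {S : Subgroup H}
    (h : Intertwines (groupVN (⊤ : Subgroup H)) (groupVN S) (vnCenter (groupVN (⊤ : Subgroup H)))) :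
    ∃ (E : Finset H) (C : ℕ), ∀ s ∈ S, ∃ k ∈ E, (conjClass (s * k)).encard ≤ C := by
  classical
  by_contra! hcon
  choose s hsS hs using hcon
  obtain ⟨p, e, hpN, hps, heM, he0, hes, hee, hpe, hep, he1, hez⟩ :=
    h.exists_projection fun x hx => groupVN_mono le_top hx
  let t : Finset H × ℕ → H := fun i => s i.1 i.2
  have ht : ∀ (k : H) (n : ℕ), ∀ᶠ i in (atTop : Filter (Finset H × ℕ)),
      n ≤ (conjClass (t i * k)).encard := by
    intro k n
    filter_upwards [eventually_ge_atTop (({k} : Finset H), n)] with i hi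
    exact (Nat.cast_le.2 hi.2).trans (hs i.1 i.2 k (hi.1 (Finset.mem_singleton_self k))).le
  let V : Submodule ℂ (lp (fun _ : H => ℂ) 2) :=
    { carrier := {ξ | Tendsto (fun i => e (leftTranslation (t i) ξ)) atTop (𝓝 0)}
      zero_mem' := by simp
      add_mem' := fun ha hb => by
        simpa only [map_add, add_zero, Set.mem_ofPred_eq] using ha.add hb
      smul_mem' := fun c a ha => by
        simpa only [map_smul, smul_zero, Set.mem_ofPred_eq] using ha.const_smul c }
  have hV : IsClosed (V : Set (lp (fun _ : H => ℂ) 2)) :=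
    isClosed_setOf_tendsto_zero (C := 1) fun i x y => by
      rw [← map_sub, ← map_sub]
      refine (e.le_of_opNorm_le he1 _).trans ?_
      rw [norm_leftTranslation_apply]
  have hmul : ∀ (a b : lp (fun _ : H => ℂ) 2 →L[ℂ] lp (fun _ : H => ℂ) 2) ξ, a (b ξ) = (a * b) ξ :=
    fun _ _ _ => rfl
  have hadj : ∀ (a : lp (fun _ : H => ℂ) 2 →L[ℂ] lp (fun _ : H => ℂ) 2) ξ η,
      ⟪a ξ, η⟫_ℂ = ⟪ξ, star a η⟫_ℂ := fun a ξ η => by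
    rw [ContinuousLinearMap.star_eq_adjoint, ContinuousLinearMap.adjoint_inner_right]
  let W : Submodule ℂ (lp (fun _ : H => ℂ) 2) :=
    Submodule.span ℂ {ξ | ∃ r ∈ S, ∃ η, leftTranslation r (p η) = ξ}
  -- Put g = t_i r. Then e u_g p η and p u_g e η both equal z_i e η, and p fixes z_i e η, so ‖e u_g
  -- p η‖² is the inner product of u_{t_i}(u_r e η) with z_i e η, which tends to 0.
  have hWV : W ≤ V := by
    refine Submodule.span_le.2 ?_
    rintro _ ⟨r, hr, η, rfl⟩
    have hz := fun i => hez (leftTranslation (t i * r))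
      (leftTranslation_mem_groupVN (S.mul_mem (hsS _ _) hr)) (norm_leftTranslation_le _)
    choose z hzA hz1 hzl hzr using hz
    have h1 := tendsto_inner_of_mem_vnCenter ht hzA hz1 (leftTranslation r (e η)) (e η)
    have h2 : ∀ i, ‖⟪leftTranslation (t i) (leftTranslation r (e η)), z i (e η)⟫_ℂ‖
        = ‖e (leftTranslation (t i) (leftTranslation r (p η)))‖ ^ 2 := by
      intro i
      have h3 : e (leftTranslation (t i) (leftTranslation r (p η))) = z i (e η) := by
        rw [hmul (leftTranslation _), ← leftTranslation_mul, hmul, hmul, hmul, ← hzl]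
      have h4 : p (z i (e η)) = z i (e η) := by
        rw [hmul (z i), hmul, ← mul_assoc,
          mul_comm_of_mem_vnCenter (hzA i) (groupVN_mono le_top hpN), mul_assoc, hpe]
      rw [h3, ← h4, ← hps, ← hadj, hps, h4, hmul (leftTranslation _), ← leftTranslation_mul, hmul,
        hmul, hzr, mul_apply_eq_comp, inner_self_eq_norm_sq_to_K]
      simp
    have h3 := h1.norm
    simp only [h2, norm_zero] at h3
    change Tendsto _ _ _
    rw [tendsto_zero_iff_norm_tendsto_zero]
    have h4 := h3.sqrt
    simpa [Real.sqrt_sq] using h4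
  -- The adjoint of e u_t is u_{t⁻¹} e = u_{t⁻¹} p e, whose range lies in W.
  have hWo : ∀ ξ ∈ Wᗮ, ∀ i, e (leftTranslation (t i) ξ) = 0 := by
    intro ξ hξ i
    refine ext_inner_left ℂ fun η => ?_
    have h1 : ⟪leftTranslation (t i)⁻¹ (p (e η)), ξ⟫_ℂ = 0 :=
      (Submodule.mem_orthogonal _ _).1 hξ _
        (Submodule.subset_span ⟨_, S.inv_mem (hsS _ _), _, rfl⟩)
    rw [hmul p, hpe, hadj, star_leftTranslation, inv_inv, hadj, hes] at h1
    rw [h1, inner_zero_right]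
  have hall : ∀ ξ, ξ ∈ V := by
    intro ξ
    have : Submodule.HasOrthogonalProjection (W.topologicalClosure) := inferInstance
    obtain ⟨a, ha, b, hb, rfl⟩ := W.topologicalClosure.exists_add_mem_mem_orthogonal ξ
    refine V.add_mem (W.topologicalClosure_minimal hWV hV ha) ?_
    rw [Submodule.orthogonal_closure] at hb
    change Tendsto _ _ _
    simp only [hWo b hb]
    exact tendsto_const_nhds
  have h1 : Tendsto (fun _ : Finset H × ℕ => ‖e (delta 1)‖) atTop (𝓝 0) := by
    have h2 : ∀ i, ‖e (leftTranslation (t i) (delta 1))‖ = ‖e (delta 1)‖ := by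
      intro i
      have h3 : e (delta (t i)) = rightTranslation (t i)⁻¹ (e (delta 1)) := by
        ext g
        rw [rightTranslation_apply]
        exact mem_groupVN_top_iff.1 heM g (t i)
      rw [leftTranslation_delta, mul_one, h3, norm_rightTranslation_apply]
    simpa only [h2, norm_zero] using (show Tendsto _ _ _ from hall (delta 1)).norm
  have h2 : e (delta 1) = 0 := norm_eq_zero.1 (tendsto_nhds_unique tendsto_const_nhds h1)
  refine he0 (eq_of_coef fun h g => ?_)
  rw [mem_groupVN_top_iff.1 heM, coef, h2]
  rfl

theorem encard_conjClass_mul_le (a b : H) :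
    (conjClass (a * b)).encard ≤ (conjClass a).encard * (conjClass b).encard := by
  have hsub : conjClass (a * b) ⊆ (fun x : H × H => x.1 * x.2) '' (conjClass a ×ˢ conjClass b) := by
    rintro _ ⟨h, rfl⟩
    exact ⟨(h * a * h⁻¹, h * b * h⁻¹), ⟨⟨h, rfl⟩, ⟨h, rfl⟩⟩, by group⟩
  refine (Set.encard_le_encard hsub).trans ((Set.encard_image_le _ _).trans ?_)
  rw [Set.encard_prod]

theorem mem_fcCenter_of_encard_le {g : H} {C : ℕ} (h : (conjClass g).encard ≤ C) :
    g ∈ fcCenter H := Set.finite_of_encard_le_coe h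

/-- If g and g k have finite classes, so has k; then g = (g k) k⁻¹ bounds the class of g by C times
that of k⁻¹. Summing over the finitely many possible k makes the bound uniform. -/
theorem Intertwines.isBFCInside_fcCenter {S : Subgroup H} (hS : fcCenter H ≤ S)
    (h : Intertwines (groupVN (⊤ : Subgroup H)) (groupVN S) (vnCenter (groupVN (⊤ : Subgroup H)))) :
    IsBFCInside (fcCenter H) := by
  classical
  obtain ⟨E, C, hEC⟩ := h.exists_finset
  have hfin : ∀ k ∈ E.filter (· ∈ fcCenter H), (conjClass k⁻¹).Finite := fun k hk =>
    (fcCenter H).inv_mem (Finset.mem_filter.1 hk).2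
  refine ⟨C * ∑ k ∈ E.filter (· ∈ fcCenter H), (conjClass k⁻¹).ncard, fun g hg => ?_⟩
  obtain ⟨k, hkE, hk⟩ := hEC g (hS hg)
  have hkf : k ∈ E.filter (· ∈ fcCenter H) :=
    Finset.mem_filter.2 ⟨hkE, ((fcCenter H).mul_mem_cancel_left hg).1 (mem_fcCenter_of_encard_le hk)⟩
  have h1 := encard_conjClass_mul_le (g * k) k⁻¹
  rw [mul_inv_cancel_right] at h1
  refine h1.trans ?_
  push_cast
  gcongr
  rw [← (hfin k hkf).cast_ncard_eq]
  exact_mod_cast Finset.single_le_sum (f := fun k => (conjClass k⁻¹).ncard)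
    (fun _ _ => Nat.zero_le _) hkf

/-- Elements s, t of S assigned the same k satisfy s t⁻¹ = (s k)(t k)⁻¹, which lies in the
FC-center; so E bounds the number of cosets. -/
theorem Intertwines.finiteIndex_fcCenter {S : Subgroup H}
    (h : Intertwines (groupVN (⊤ : Subgroup H)) (groupVN S) (vnCenter (groupVN (⊤ : Subgroup H)))) :
    ((fcCenter H).subgroupOf S).FiniteIndex := by
  obtain ⟨E, C, hEC⟩ := h.exists_finset
  choose k hkE hk using fun s : S => hEC s s.2
  have hinj : ∀ s t : S, k s = k t → s * t⁻¹ ∈ (fcCenter H).subgroupOf S := by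
    intro s t hst
    have h1 := (fcCenter H).mul_mem (mem_fcCenter_of_encard_le (hk s))
      ((fcCenter H).inv_mem (mem_fcCenter_of_encard_le (hk t)))
    rw [hst, show (s : H) * k t * (t * k t)⁻¹ = s * (t : H)⁻¹ by group] at h1
    exact h1
  have : Finite (S ⧸ (fcCenter H).subgroupOf S) := by
    refine Finite.of_injective (β := E) (fun q => ⟨k q.out, hkE _⟩) fun a b hab => ?_
    have h1 := hinj _ _ (Subtype.mk.inj hab)
    rw [← QuotientGroup.out_eq' a, ← QuotientGroup.out_eq' b, eq_comm, QuotientGroup.eq]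
    exact (Subgroup.Normal.mem_comm_iff inferInstance).1 h1
  exact Subgroup.finiteIndex_of_finite_quotient

end Intertwining

/-! ### Central supports and projections with central corners -/

section CentralSupport

theorem map_topologicalClosure_span {E : Type*} [NormedAddCommGroup E] [InnerProductSpace ℂ E]
    {s : Set E} {b : E →L[ℂ] E}
    (h : ∀ ξ ∈ s, b ξ ∈ Submodule.span ℂ s) {ξ : E}
    (hξ : ξ ∈ (Submodule.span ℂ s).topologicalClosure) :
    b ξ ∈ (Submodule.span ℂ s).topologicalClosure := by
  have hle : Submodule.span ℂ s ≤ ((Submodule.span ℂ s).topologicalClosure).comap b.toLinearMap :=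
    Submodule.span_le.2 fun η hη => Submodule.le_topologicalClosure _ (h η hη)
  refine Submodule.topologicalClosure_minimal _ hle ?_ hξ
  exact (Submodule.isClosed_topologicalClosure _).preimage b.continuous

variable {E : Type*} [NormedAddCommGroup E] [InnerProductSpace ℂ E] [CompleteSpace E]

/-- `c` is the central support of `p` in `M`. -/
structure IsCentralSupport (M : VonNeumannAlgebra E) (p c : E →L[ℂ] E) : Prop where
  isStarProjection : IsStarProjection c
  mem : c ∈ vnCenter M
  mul_eq : c * p = p
  mul_eq_zero : ∀ a ∈ vnCenter M, a * p = 0 → a * c = 0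

variable {M N : VonNeumannAlgebra E} {p c x y : E →L[ℂ] E}

theorem mem_vonNeumannAlgebra_of_forall_commutant
    (h : ∀ b ∈ N.commutant, b * x = x * b) : x ∈ N := by
  rw [← N.commutant_commutant]
  exact VonNeumannAlgebra.mem_commutant_iff.2 h

theorem posPart_mem (hx : x ∈ N) : x⁺ ∈ N :=
  mem_vonNeumannAlgebra_of_forall_commutant fun b hb => by
    have h : Commute x b := VonNeumannAlgebra.mem_commutant_iff.1 hb x hx
    exact (h.cfcₙ_real _).eq.symm

theorem negPart_mem (hx : x ∈ N) : x⁻ ∈ N :=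
  mem_vonNeumannAlgebra_of_forall_commutant fun b hb => by
    have h : Commute x b := VonNeumannAlgebra.mem_commutant_iff.1 hb x hx
    exact (h.cfcₙ_real _).eq.symm

theorem starProjection_mem (K : Submodule ℂ E) [K.HasOrthogonalProjection]
    (h : ∀ b ∈ N.commutant, ∀ ξ ∈ K, b ξ ∈ K) : K.starProjection ∈ N := by
  refine (VonNeumannAlgebra.IsStarProjection.mem_iff isStarProjection_starProjection N).2
    fun b hb => ?_
  rw [Submodule.range_starProjection]
  exact fun ξ hξ => h b hb ξ hξ

theorem mul_starProjection_eq_zero {s : Set E} {b : E →L[ℂ] E} (h : ∀ ξ ∈ s, b ξ = 0) :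
    b * (Submodule.span ℂ s).topologicalClosure.starProjection = 0 := by
  have hle : (Submodule.span ℂ s).topologicalClosure ≤ b.ker :=
    Submodule.topologicalClosure_minimal _ (Submodule.span_le.2 h) b.isClosed_ker
  ext ξ
  exact hle (Submodule.starProjection_apply_mem _ ξ)

/-- The projection onto the closed span of M p E is invariant under both M and its commutant. -/
theorem exists_isCentralSupport (p : E →L[ℂ] E) (hp : p ∈ M) : ∃ c, IsCentralSupport M p c := by
  let s : Set E := {ξ | ∃ y ∈ M, ∃ η, y (p η) = ξ}
  refine ⟨(Submodule.span ℂ s).topologicalClosure.starProjection,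
    isStarProjection_starProjection, ⟨?_, ?_⟩, ?_, ?_⟩
  · refine starProjection_mem _ fun b hb ξ hξ => map_topologicalClosure_span ?_ hξ
    rintro _ ⟨y, hy, η, rfl⟩
    refine Submodule.subset_span ⟨y, hy, b η, ?_⟩
    have h1 := VonNeumannAlgebra.mem_commutant_iff.1 hb y hy
    have h2 := VonNeumannAlgebra.mem_commutant_iff.1 hb p hp
    change (y * (p * b)) η = (b * y * p) η
    rw [h2, ← mul_assoc, h1]
  · refine starProjection_mem (N := M.commutant) _ fun b hb ξ hξ =>
      map_topologicalClosure_span ?_ hξ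
    rw [M.commutant_commutant] at hb
    rintro _ ⟨y, hy, η, rfl⟩
    exact Submodule.subset_span ⟨b * y, mul_mem hb hy, η, rfl⟩
  · ext ξ
    exact Submodule.starProjection_eq_self_iff.2
      (Submodule.le_topologicalClosure _ (Submodule.subset_span ⟨1, one_mem M, ξ, rfl⟩))
  · intro a ha hap
    refine mul_starProjection_eq_zero ?_
    rintro _ ⟨y, hy, η, rfl⟩
    change (a * y * p) η = 0
    rw [← mul_comm_of_mem_vnCenter ha hy, mul_assoc, hap, mul_zero]
    rfl

/-- Range projections of elements of a von Neumann algebra. -/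
theorem exists_rangeProjection (hx : x ∈ N) :
    ∃ r ∈ N, IsStarProjection r ∧ r * x = x ∧ ∀ b : E →L[ℂ] E, b * x = 0 → b * r = 0 := by
  refine ⟨(Submodule.span ℂ (Set.range x)).topologicalClosure.starProjection, ?_,
    isStarProjection_starProjection, ?_, ?_⟩
  · refine starProjection_mem _ fun b hb ξ hξ => map_topologicalClosure_span ?_ hξ
    rintro _ ⟨η, rfl⟩
    refine Submodule.subset_span ⟨b η, ?_⟩
    exact congrArg (fun z : E →L[ℂ] E => z η) (VonNeumannAlgebra.mem_commutant_iff.1 hb x hx)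
  · ext ξ
    exact Submodule.starProjection_eq_self_iff.2
      (Submodule.le_topologicalClosure _ (Submodule.subset_span ⟨ξ, rfl⟩))
  · intro b hb
    refine mul_starProjection_eq_zero ?_
    rintro _ ⟨η, rfl⟩
    exact congrArg (fun z : E →L[ℂ] E => z η) hb

theorem IsStarProjection.mul_comm_of_mem_vnCenter {z : E →L[ℂ] E} (hp : IsStarProjection p)
    (hpM : p ∈ M) (hz : IsStarProjection z) (hzA : z ∈ vnCenter M) : IsStarProjection (z * p) :=
  hz.mul hp (_root_.mul_comm_of_mem_vnCenter hzA hpM).symm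

theorem IsCentralSupport.mul {z : E →L[ℂ] E} (h : IsCentralSupport M p c) (hz : IsStarProjection z)
    (hzA : z ∈ vnCenter M) : IsCentralSupport M (z * p) (z * c) where
  isStarProjection := h.isStarProjection.mul_comm_of_mem_vnCenter (mem_of_mem_vnCenter h.mem) hz hzA
  mem := mul_mem hzA h.mem
  mul_eq := by
    have hzz : z * z = z := hz.isIdempotentElem
    rw [mul_assoc, ← mul_assoc c, ← mul_comm_of_mem_vnCenter h.mem (mem_of_mem_vnCenter hzA),
      mul_assoc z c, h.mul_eq, ← mul_assoc, hzz]
  mul_eq_zero a ha hap := by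
    rw [← mul_assoc] at hap ⊢
    exact h.mul_eq_zero _ (mul_mem ha hzA) hap

theorem IsCentralSupport.of_mem (hc : IsStarProjection c) (hcA : c ∈ vnCenter M) :
    IsCentralSupport M c c := ⟨hc, hcA, hc.isIdempotentElem, fun _ _ h => h⟩

/-- A projection is centrally homogeneous if orthogonal subprojections have orthogonal central
supports. -/
def IsCentrallyHomogeneous (M N : VonNeumannAlgebra E) (p : E →L[ℂ] E) : Prop :=
  ∀ r₁ ∈ N, ∀ r₂ ∈ N, IsStarProjection r₁ → IsStarProjection r₂ → p * r₁ = r₁ → p * r₂ = r₂ →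
    r₁ * r₂ = 0 → ∀ c₁ c₂, IsCentralSupport M r₁ c₁ → IsCentralSupport M r₂ c₂ → c₁ * c₂ = 0

/-- A list of pairwise orthogonal projections in `N` below `e` with the same central support. -/
structure IsEqualSupportFamily (M N : VonNeumannAlgebra E) (e z : E →L[ℂ] E)
    (l : List (E →L[ℂ] E)) : Prop where
  ne_zero : z ≠ 0
  mem : ∀ q ∈ l, q ∈ N ∧ IsStarProjection q ∧ e * q = q ∧ IsCentralSupport M q z
  pairwise : l.Pairwise fun a b => a * b = 0

/-- If q is not homogeneous it has orthogonal subprojections r₁, r₂ whose central supports have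
nonzero product c₁c₂. Replacing q by r₁, r₂ and cutting everything by c₁c₂ restores a common support
and lengthens the family by one. -/
theorem IsEqualSupportFamily.exists_cons {e z q : E →L[ℂ] E} {l : List (E →L[ℂ] E)}
    (hNM : ∀ x ∈ N, x ∈ M) (hAN : ∀ x ∈ vnCenter M, x ∈ N) (he : e ∈ vnCenter M)
    (h : IsEqualSupportFamily M N e z (q :: l)) (hq : ¬ IsCentrallyHomogeneous M N q) :
    ∃ z' r₁ r₂ l', l'.length = l.length ∧ IsEqualSupportFamily M N e z' (r₁ :: r₂ :: l') := by
  simp only [IsCentrallyHomogeneous, not_forall] at hq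
  obtain ⟨r₁, hr₁N, r₂, hr₂N, hr₁, hr₂, hqr₁, hqr₂, hr₁₂, c₁, c₂, hc₁, hc₂, hcc⟩ := hq
  obtain ⟨hqN, hqp, heq, hqz⟩ := h.mem q List.mem_cons_self
  have hlt : ∀ b ∈ l, q * b = 0 := (List.pairwise_cons.1 h.pairwise).1
  have hzc : ∀ r d, q * r = r → IsCentralSupport M r d → z * d = d := by
    intro r d hqr hd
    have h1 : (1 - z) * d = 0 := hd.mul_eq_zero _ (sub_mem (one_mem _) hqz.mem) (by
      rw [← hqr, ← mul_assoc, sub_mul, one_mul, hqz.mul_eq, sub_self, zero_mul])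
    rwa [sub_mul, one_mul, sub_eq_zero, eq_comm] at h1
  have hAM : ∀ x ∈ vnCenter M, x ∈ M := fun x => mem_of_mem_vnCenter
  have hcomm : c₂ * c₁ = c₁ * c₂ := mul_comm_of_mem_vnCenter hc₁.mem (hAM _ hc₂.mem)
  have hz'A : c₁ * c₂ ∈ vnCenter M := mul_mem hc₁.mem hc₂.mem
  have hz' : IsStarProjection (c₁ * c₂) := hc₁.isStarProjection.mul hc₂.isStarProjection hcomm.symm
  have h11 : c₁ * c₁ = c₁ := hc₁.isStarProjection.isIdempotentElem
  have h22 : c₂ * c₂ = c₂ := hc₂.isStarProjection.isIdempotentElem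
  have hgen : ∀ r d, r ∈ N → IsStarProjection r → e * r = r → IsCentralSupport M r d →
      c₁ * c₂ * d = c₁ * c₂ → c₁ * c₂ * r ∈ N ∧ IsStarProjection (c₁ * c₂ * r) ∧
        e * (c₁ * c₂ * r) = c₁ * c₂ * r ∧ IsCentralSupport M (c₁ * c₂ * r) (c₁ * c₂) := by
    intro r d hrN hr her hrd hd
    refine ⟨mul_mem (hAN _ hz'A) hrN, hr.mul_comm_of_mem_vnCenter (hNM r hrN) hz' hz'A, ?_, ?_⟩
    · rw [← mul_assoc, mul_comm_of_mem_vnCenter hz'A (hAM _ he), mul_assoc, her]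
    · have := hrd.mul hz' hz'A
      rwa [hd] at this
  have horth : ∀ a b : E →L[ℂ] E, a ∈ N → a * b = 0 → c₁ * c₂ * a * (c₁ * c₂ * b) = 0 := by
    intro a b ha hab
    rw [mul_assoc (c₁ * c₂) a, ← mul_assoc a, mul_comm_of_mem_vnCenter hz'A (hNM a ha),
      mul_assoc _ a b, hab, mul_zero, mul_zero]
  have hsub : ∀ r, q * r = r → IsStarProjection r → ∀ b ∈ l, r * b = 0 := by
    intro r hqr hr b hb
    have hs : r * q = r := by
      have := congrArg star hqr
      rwa [star_mul, hr.isSelfAdjoint.star_eq, hqp.isSelfAdjoint.star_eq] at this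
    rw [← hs, mul_assoc, hlt b hb, mul_zero]
  refine ⟨c₁ * c₂, c₁ * c₂ * r₁, c₁ * c₂ * r₂, l.map (c₁ * c₂ * ·), by simp, hcc, ?_, ?_⟩
  · simp only [List.mem_cons, List.mem_map]
    rintro _ (rfl | rfl | ⟨b, hb, rfl⟩)
    · exact hgen r₁ c₁ hr₁N hr₁ (by rw [← hqr₁, ← mul_assoc, heq]) hc₁
        (by rw [mul_assoc, hcomm, ← mul_assoc, h11])
    · exact hgen r₂ c₂ hr₂N hr₂ (by rw [← hqr₂, ← mul_assoc, heq]) hc₂ (by rw [mul_assoc, h22])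
    · obtain ⟨h1, h2, h3, h4⟩ := h.mem b (List.mem_cons_of_mem _ hb)
      refine hgen b z h1 h2 h3 h4 ?_
      rw [mul_comm_of_mem_vnCenter hqz.mem (hAM _ hz'A), ← mul_assoc, hzc r₁ c₁ hqr₁ hc₁]
  · simp only [List.pairwise_cons, List.mem_cons, List.mem_map]
    refine ⟨?_, ?_, ?_⟩
    · rintro _ (rfl | ⟨b, hb, rfl⟩)
      · exact horth _ _ hr₁N hr₁₂
      · exact horth _ _ hr₁N (hsub r₁ hqr₁ hr₁ b hb)
    · rintro _ ⟨b, hb, rfl⟩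
      exact horth _ _ hr₂N (hsub r₂ hqr₂ hr₂ b hb)
    · refine List.pairwise_map.2 ?_
      refine (List.pairwise_cons.1 h.pairwise).2.imp_of_mem ?_
      intro a b ha _ hab
      exact horth a b (h.mem a (List.mem_cons_of_mem _ ha)).1 hab

/-- Otherwise, starting from e alone (its own central support), splitting could be repeated past the
bound C. -/
theorem exists_isCentrallyHomogeneous {e : E →L[ℂ] E} (hNM : ∀ x ∈ N, x ∈ M)
    (hAN : ∀ x ∈ vnCenter M, x ∈ N) (he : IsStarProjection e) (heA : e ∈ vnCenter M) (he0 : e ≠ 0)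
    {C : ℕ} (hC : ∀ z l, IsEqualSupportFamily M N e z l → l.length ≤ C) :
    ∃ p ∈ N, IsStarProjection p ∧ p ≠ 0 ∧ IsCentrallyHomogeneous M N p := by
  by_contra! hcon
  have key : ∀ n : ℕ, ∃ z q l, l.length = n ∧ IsEqualSupportFamily M N e z (q :: l) := by
    intro n
    induction n with
    | zero =>
      refine ⟨e, e, [], rfl, he0, ?_, List.pairwise_singleton _ _⟩
      simp only [List.mem_singleton]
      rintro _ rfl
      exact ⟨hAN _ heA, he, he.isIdempotentElem, .of_mem he heA⟩
    | succ n ih =>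
      obtain ⟨z, q, l, hl, hf⟩ := ih
      obtain ⟨hqN, hq, -, hqz⟩ := hf.mem q List.mem_cons_self
      have hq0 : q ≠ 0 := by
        rintro rfl
        refine hf.ne_zero ?_
        have := hqz.mul_eq_zero 1 (one_mem _) (mul_zero _)
        rwa [one_mul] at this
      obtain ⟨z', r₁, r₂, l', hl', hf'⟩ := hf.exists_cons hNM hAN heA (hcon q hqN hq hq0)
      exact ⟨z', r₁, r₂ :: l', by simp [hl', hl], hf'⟩
  obtain ⟨z, q, l, hl, hf⟩ := key C
  have := hC _ _ hf
  simp [hl] at this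

end CentralSupport

/-! ### Corners of centrally homogeneous projections via binary expansion -/

section CentralCorner

variable {E : Type*} [NormedAddCommGroup E] [InnerProductSpace ℂ E] [CompleteSpace E]

variable {M N : VonNeumannAlgebra E} {p x y : E →L[ℂ] E}

open Filter Topology

/-- The central support c of r is orthogonal to that of p - r, so c kills p - r and c p = c r = r.
-/
theorem IsCentrallyHomogeneous.exists_eq_mul (hNM : ∀ x ∈ N, x ∈ M)
    (h : IsCentrallyHomogeneous M N p) (hpN : p ∈ N) (hp : IsStarProjection p) {r : E →L[ℂ] E}
    (hrN : r ∈ N) (hr : IsStarProjection r) (hpr : p * r = r) :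
    ∃ c ∈ vnCenter M, IsStarProjection c ∧ c * p = r := by
  obtain ⟨c, hc⟩ := exists_isCentralSupport r (hNM r hrN)
  obtain ⟨d, hd⟩ := exists_isCentralSupport (p - r) (sub_mem (hNM p hpN) (hNM r hrN))
  have hrr : r * r = r := hr.isIdempotentElem
  have hpp : p * p = p := hp.isIdempotentElem
  have hsub : IsStarProjection (p - r) := hr.sub_of_mul_eq_right hp hpr
  have hcd := h r hrN (p - r) (sub_mem hpN hrN) hr hsub hpr (by rw [mul_sub, hpp, hpr])
    (by
      have hrp : r * p = r := by
        have := congrArg star hpr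
        rwa [star_mul, hr.isSelfAdjoint.star_eq, hp.isSelfAdjoint.star_eq] at this
      rw [mul_sub, hrp, hrr, sub_self]) c d hc hd
  refine ⟨c, hc.mem, hc.isStarProjection, ?_⟩
  have h1 : c * (p - r) = 0 := by rw [← hd.mul_eq, ← mul_assoc, hcd, zero_mul]
  rwa [mul_sub, hc.mul_eq, sub_eq_zero] at h1

theorem mul_eq_zero_of_mul_mul_eq_zero {a b : E →L[ℂ] E} (hb : star b = b) (h : a * (b * b) = 0) :
    a * b = 0 := by
  have h1 : a * b * star (a * b) = 0 := by
    rw [star_mul, hb, ← mul_assoc, mul_assoc a, h, zero_mul]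
  exact CStarRing.mul_star_self_eq_zero_iff _ |>.1 h1

theorem mul_posPart_eq_zero {a : E →L[ℂ] E} (hy : IsSelfAdjoint y) (h : a * y = 0) : a * y⁺ = 0 := by
  refine mul_eq_zero_of_mul_mul_eq_zero (CFC.posPart_nonneg y).isSelfAdjoint.star_eq ?_
  have h1 : y⁺ * y⁺ = y * y⁺ := by
    conv_rhs => rw [← CFC.posPart_sub_negPart y hy]
    rw [sub_mul, CFC.posPart_sub_negPart y hy, CFC.negPart_mul_posPart, sub_zero]
  rw [h1, ← mul_assoc, h, zero_mul]

theorem mul_negPart_eq_zero {a : E →L[ℂ] E} (hy : IsSelfAdjoint y) (h : a * y = 0) : a * y⁻ = 0 := by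
  rw [← CFC.posPart_neg]
  exact mul_posPart_eq_zero hy.neg (by rw [mul_neg, h, neg_zero])

theorem mul_nonneg_of_isStarProjection {c : E →L[ℂ] E} (hc : IsStarProjection c) (hx : 0 ≤ x)
    (h : x * c = c * x) : 0 ≤ c * x := by
  have h1 := star_right_conjugate_nonneg hx c
  have hcc : c * c = c := hc.isIdempotentElem
  rwa [hc.isSelfAdjoint.star_eq, mul_assoc, h, ← mul_assoc, hcc] at h1

/-- One binary digit of a positive contraction in a centrally homogeneous corner. -/
theorem IsCentrallyHomogeneous.exists_digit (hNM : ∀ x ∈ N, x ∈ M)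
    (h : IsCentrallyHomogeneous M N p) (hpN : p ∈ N) (hp : IsStarProjection p)
    (hxN : x ∈ N) (hpx : p * x = x) (hx0 : 0 ≤ x) (hxp : x ≤ p) :
    ∃ c ∈ vnCenter M, ‖c‖ ≤ 1 ∧ ∃ x' ∈ N, p * x' = x' ∧ 0 ≤ x' ∧ x' ≤ p ∧
      x = (1 / 2 : ℂ) • (c * p + x') := by
  have hpp : p * p = p := hp.isIdempotentElem
  have hps : star p = p := hp.isSelfAdjoint.star_eq
  have hxs : star x = x := hx0.isSelfAdjoint.star_eq
  -- The digit is the spectral projection r of x above 1/2, namely the range projection of y⁺. It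
  -- has the form c p with c central, and the remainder is x' = 2x - r.
  set y : E →L[ℂ] E := x + x - p with hy
  have hys : IsSelfAdjoint y := by
    rw [IsSelfAdjoint, hy, star_sub, star_add, hxs, hps]
  have hyN : y ∈ N := sub_mem (add_mem hxN hxN) hpN
  have hpy : (1 - p) * y = 0 := by
    rw [hy, sub_mul, one_mul, mul_sub, mul_add, hpx, hpp, sub_self]
  obtain ⟨r, hrN, hr, hry, hrb⟩ := exists_rangeProjection (posPart_mem hyN)
  have hpr : p * r = r := by
    have := hrb _ (mul_posPart_eq_zero hys hpy)
    rw [sub_mul, one_mul, sub_eq_zero] at this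
    exact this.symm
  have hpy1 : p * y⁺ = y⁺ := by
    have := mul_posPart_eq_zero hys hpy
    rw [sub_mul, one_mul, sub_eq_zero] at this
    exact this.symm
  have hpy2 : p * y⁻ = y⁻ := by
    have := mul_negPart_eq_zero hys hpy
    rw [sub_mul, one_mul, sub_eq_zero] at this
    exact this.symm
  obtain ⟨c, hcA, hc, hcp⟩ := h.exists_eq_mul hNM hpN hp hrN hr hpr
  have hcp' : ∀ w : E →L[ℂ] E, p * w = w → c * w = r * w := fun w hw => by
    rw [← hcp, mul_assoc, hw]
  have hcy1 : c * y⁺ = y⁺ := by rw [hcp' _ hpy1, hry]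
  have hcy2 : c * y⁻ = 0 := by
    have h1 : y⁻ * r = 0 := hrb _ (CFC.negPart_mul_posPart y)
    have h2 := congrArg star h1
    rw [star_mul, star_zero, hr.isSelfAdjoint.star_eq,
      (CFC.negPart_nonneg y).isSelfAdjoint.star_eq] at h2
    rw [hcp' _ hpy2, h2]
  have hcomm : ∀ w ∈ N, w * c = c * w := fun w hw => mul_comm_of_mem_vnCenter hcA (hNM w hw)
  have hcomm' : ∀ w ∈ N, w * (1 - c) = (1 - c) * w := fun w hw => by
    rw [mul_sub, sub_mul, mul_one, one_mul, hcomm w hw]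
  have hyd : y⁺ - y⁻ = y := CFC.posPart_sub_negPart y hys
  -- From c y⁺ = y⁺ and c y⁻ = 0, both x' and p - x' become sums of visibly positive terms.
  have e1 : x + x - r = (1 - c) * (x + x) + y⁺ := by
    have : c * y = y⁺ := by
      have h1 := congrArg (c * ·) hyd
      simp only [mul_sub, hcy1, hcy2, sub_zero] at h1
      exact h1.symm
    rw [← this, hy, mul_sub c, hcp]
    noncomm_ring
  have e2 : p - (x + x - r) = c * (p - x) + c * (p - x) + y⁻ := by
    have : (1 - c) * y = -y⁻ := by
      have h1 := congrArg ((1 - c) * ·) hyd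
      simp only [mul_sub, sub_mul, one_mul, hcy1, hcy2, sub_self, zero_sub, sub_zero] at h1
      rw [sub_mul, one_mul, ← h1]
    rw [eq_comm, neg_eq_iff_eq_neg.1 this.symm, hy, ← hcp]
    noncomm_ring
  refine ⟨c, hcA, hc.norm_le, x + x - r, sub_mem (add_mem hxN hxN) hrN, ?_, ?_, ?_, ?_⟩
  · rw [mul_sub, mul_add, hpx, hpr]
  · rw [e1]
    exact add_nonneg (mul_nonneg_of_isStarProjection hc.one_sub (add_nonneg hx0 hx0)
      (hcomm' _ (add_mem hxN hxN))) (CFC.posPart_nonneg y)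
  · rw [← sub_nonneg, e2]
    have h1 := mul_nonneg_of_isStarProjection hc (sub_nonneg.2 hxp) (hcomm _ (sub_mem hpN hxN))
    exact add_nonneg (add_nonneg h1 h1) (CFC.negPart_nonneg y)
  · rw [hcp, add_sub_cancel, ← two_smul ℂ x, smul_smul]
    norm_num

/-- Iterating the digit step, a = Σ 2^{-(n+1)} c_n converges in norm within the center, and the
remainder after n steps has norm at most 2^{-n}. -/
theorem IsCentrallyHomogeneous.exists_eq_mul_of_le (hNM : ∀ x ∈ N, x ∈ M)
    (h : IsCentrallyHomogeneous M N p) (hpN : p ∈ N) (hp : IsStarProjection p)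
    (hxN : x ∈ N) (hpx : p * x = x) (hx0 : 0 ≤ x) (hxp : x ≤ p) :
    ∃ a ∈ vnCenter M, x = a * p := by
  let X := {x : E →L[ℂ] E // x ∈ N ∧ p * x = x ∧ 0 ≤ x ∧ x ≤ p}
  have hstep : ∀ x : X, ∃ c ∈ vnCenter M, ‖c‖ ≤ 1 ∧ ∃ x' : X,
      (x : E →L[ℂ] E) = (1 / 2 : ℂ) • (c * p + x') := by
    rintro ⟨x, h1, h2, h3, h4⟩
    obtain ⟨c, hc, hc1, x', h1', h2', h3', h4', hx'⟩ := h.exists_digit hNM hpN hp h1 h2 h3 h4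
    exact ⟨c, hc, hc1, ⟨x', h1', h2', h3', h4'⟩, hx'⟩
  choose c hcA hc1 T hT using hstep
  let x₀ : X := ⟨x, hxN, hpx, hx0, hxp⟩
  let d : ℕ → E →L[ℂ] E := fun n => (1 / 2 : ℂ) ^ (n + 1) • c (T^[n] x₀)
  have hsum : Summable d := by
    refine Summable.of_norm_bounded (g := fun n : ℕ => (1 / 2 : ℝ) ^ n) summable_geometric_two ?_
    intro n
    rw [norm_smul, norm_pow]
    have h1 : ‖(1 / 2 : ℂ)‖ = 1 / 2 := by norm_num
    rw [h1]
    calc (1 / 2 : ℝ) ^ (n + 1) * ‖c (T^[n] x₀)‖ ≤ (1 / 2 : ℝ) ^ n * 1 := by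
          refine mul_le_mul ?_ (hc1 _) (norm_nonneg _) (by positivity)
          exact pow_le_pow_of_le_one (by norm_num) (by norm_num) (Nat.le_succ n)
      _ = _ := mul_one _
  have hpart : ∀ n : ℕ, x = (∑ k ∈ Finset.range n, d k) * p + (1 / 2 : ℂ) ^ n • (T^[n] x₀).1 := by
    intro n
    induction n with
    | zero => simp [x₀]
    | succ n ih =>
      rw [Finset.sum_range_succ, add_mul, add_assoc, Function.iterate_succ_apply']
      conv_lhs => rw [ih, hT]
      simp only [d, smul_add, smul_smul, smul_mul_assoc, ← pow_succ]
  refine ⟨∑' n, d n, ?_, ?_⟩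
  · refine (isClosed_vonNeumannAlgebra (vnCenter M)).mem_of_tendsto hsum.hasSum.tendsto_sum_nat
      (Eventually.of_forall fun n => ?_)
    exact sum_mem fun k _ => (vnCenter M).toStarSubalgebra.smul_mem (hcA _) _
  · have h1 : Tendsto (fun n : ℕ => (∑ k ∈ Finset.range n, d k) * p + (1 / 2 : ℂ) ^ n •
        (T^[n] x₀).1) atTop (𝓝 ((∑' n, d n) * p + 0)) := by
      refine (hsum.hasSum.tendsto_sum_nat.mul_const p).add ?_
      refine squeeze_zero_norm (a := fun n : ℕ => (1 / 2 : ℝ) ^ n) (fun n => ?_)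
        (tendsto_pow_atTop_nhds_zero_of_lt_one (by norm_num) (by norm_num))
      rw [norm_smul, norm_pow]
      have h1 : ‖(1 / 2 : ℂ)‖ = 1 / 2 := by norm_num
      have h2 : ‖(T^[n] x₀).1‖ ≤ 1 :=
        (CStarAlgebra.norm_le_norm_of_nonneg_of_le (T^[n] x₀).2.2.2.1
          (T^[n] x₀).2.2.2.2).trans hp.norm_le
      rw [h1]
      exact mul_le_of_le_one_right (by positivity) h2
    simp only [← hpart, add_zero] at h1
    exact tendsto_nhds_unique tendsto_const_nhds h1

theorem IsCentrallyHomogeneous.corner_subset (hNM : ∀ x ∈ N, x ∈ M)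
    (h : IsCentrallyHomogeneous M N p) (hpN : p ∈ N) (hp : IsStarProjection p)
    (hyN : y ∈ N) : ∃ a ∈ vnCenter M, p * y * p = a * p := by
  have hpp : p * p = p := hp.isIdempotentElem
  have hps : star p = p := hp.isSelfAdjoint.star_eq
  have hpos : ∀ y ∈ N, 0 ≤ y → ∃ a ∈ vnCenter M, p * y * p = a * p := by
    intro y hyN hy
    have h1 : y ≤ algebraMap ℝ _ ‖y‖ := hy.isSelfAdjoint.le_algebraMap_norm_self
    have h2 : p * y * p ≤ ‖y‖ • p := by
      have := star_left_conjugate_le_conjugate h1 p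
      rwa [hps, Algebra.algebraMap_eq_smul_one, mul_smul_comm, mul_one, smul_mul_assoc, hpp] at this
    have h3 : 0 ≤ p * y * p := by
      have := star_left_conjugate_nonneg hy p
      rwa [hps] at this
    rcases eq_or_ne y 0 with rfl | hy0
    · exact ⟨0, zero_mem _, by simp⟩
    have hpos : 0 < ‖y‖ := norm_pos_iff.2 hy0
    obtain ⟨a, ha, hap⟩ := h.exists_eq_mul_of_le (x := ((‖y‖⁻¹ : ℝ) : ℂ) • (p * y * p)) hNM hpN hp
      (N.toStarSubalgebra.smul_mem (mul_mem (mul_mem hpN hyN) hpN) _)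
      (by rw [mul_smul_comm, ← mul_assoc, ← mul_assoc, hpp])
      (by
        rw [Complex.coe_smul]
        exact smul_nonneg (by positivity) h3)
      (by
        rw [Complex.coe_smul]
        have := smul_le_smul_of_nonneg_left h2 (inv_nonneg.2 hpos.le)
        rwa [smul_smul, inv_mul_cancel₀ hpos.ne', one_smul] at this)
    refine ⟨(‖y‖ : ℂ) • a, (vnCenter M).toStarSubalgebra.smul_mem ha _, ?_⟩
    rw [smul_mul_assoc, ← hap, smul_smul, ← Complex.ofReal_mul, mul_inv_cancel₀ hpos.ne',
      Complex.ofReal_one, one_smul]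
  have hadd : ∀ y z : E →L[ℂ] E, (∃ a ∈ vnCenter M, p * y * p = a * p) →
      (∃ a ∈ vnCenter M, p * z * p = a * p) → ∃ a ∈ vnCenter M, p * (y + z) * p = a * p := by
    rintro y z ⟨a, ha, hya⟩ ⟨b, hb, hzb⟩
    exact ⟨a + b, add_mem ha hb, by rw [mul_add, add_mul, hya, hzb, add_mul]⟩
  have hsmul : ∀ (t : ℂ) (y : E →L[ℂ] E), (∃ a ∈ vnCenter M, p * y * p = a * p) →
      ∃ a ∈ vnCenter M, p * (t • y) * p = a * p := by
    rintro t y ⟨a, ha, hya⟩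
    exact ⟨t • a, (vnCenter M).toStarSubalgebra.smul_mem ha t, by
      rw [mul_smul_comm, smul_mul_assoc, hya, smul_mul_assoc]⟩
  have hsa : ∀ y ∈ N, IsSelfAdjoint y → ∃ a ∈ vnCenter M, p * y * p = a * p := by
    intro y hyN hy
    rw [← CFC.posPart_sub_negPart y hy, sub_eq_add_neg, ← neg_one_smul ℂ]
    exact hadd _ _ (hpos _ (posPart_mem hyN) (CFC.posPart_nonneg y))
      (hsmul _ _ (hpos _ (negPart_mem hyN) (CFC.negPart_nonneg y)))
  have h1 := hsa (y + star y) (add_mem hyN (star_mem hyN)) (IsSelfAdjoint.add_star_self y)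
  have h2 := hsa (Complex.I • (y - star y))
    (N.toStarSubalgebra.smul_mem (sub_mem hyN (star_mem hyN)) _) (by
      rw [IsSelfAdjoint, star_smul, star_sub, star_star, ← neg_sub, smul_neg]
      simp)
  have h3 : y = (1 / 2 : ℂ) • (y + star y) +
      (-(1 / 2) * Complex.I : ℂ) • (Complex.I • (y - star y)) := by
    rw [smul_smul, mul_assoc, Complex.I_mul_I]
    module
  rw [h3]
  exact hadd _ _ (hsmul _ _ h1) (hsmul _ _ h2)

/-- An element of the center below the central support c of p is determined by its product with p.
Choosing a with a c = a and a p = x therefore defines a *-homomorphism, used with q = 1 and v = p.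
-/
theorem intertwines_vnCenter_of_corner (hNM : ∀ x ∈ N, x ∈ M) (hpN : p ∈ N)
    (hp : IsStarProjection p) (hp0 : p ≠ 0)
    (hcorner : ∀ y ∈ N, ∃ a ∈ vnCenter M, p * y * p = a * p) : Intertwines M N (vnCenter M) := by
  have hpp : p * p = p := hp.isIdempotentElem
  have hps : star p = p := hp.isSelfAdjoint.star_eq
  obtain ⟨c, hc⟩ := exists_isCentralSupport p (hNM p hpN)
  have hcc : c * c = c := hc.isStarProjection.isIdempotentElem
  have hex : ∀ x : vnCorner N p hp hpN, ∃ a : E →L[ℂ] E, a ∈ vnCenter M ∧ a * c = a ∧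
      a * p = x := by
    rintro ⟨_, y, hy, rfl⟩
    obtain ⟨a, ha, hya⟩ := hcorner y hy
    exact ⟨a * c, mul_mem ha hc.mem, by rw [mul_assoc, hcc], by
      rw [mul_assoc, hc.mul_eq]; exact hya.symm⟩
  have huniq : ∀ a b : E →L[ℂ] E, a ∈ vnCenter M → a * c = a → b ∈ vnCenter M → b * c = b →
      a * p = b * p → a = b := by
    intro a b ha hac hb hbc hab
    have h1 := hc.mul_eq_zero (a - b) (sub_mem ha hb) (by rw [sub_mul, hab, sub_self])
    rwa [sub_mul, hac, hbc, sub_eq_zero] at h1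
  choose θ hθA hθc hθp using hex
  have hmem : ∀ x, θ x ∈ vnCorner (vnCenter M) 1 (.one _) (one_mem _) := fun x =>
    ⟨θ x, hθA x, by rw [one_mul, mul_one]⟩
  have hsmul : ∀ (t : ℂ) x, θ (t • x) = t • θ x := fun t x =>
    huniq _ _ (hθA _) (hθc _) ((vnCenter M).toStarSubalgebra.smul_mem (hθA x) t)
      (by rw [smul_mul_assoc, hθc]) (by rw [hθp, smul_mul_assoc, hθp]; rfl)
  have hzero : θ 0 = 0 := huniq _ _ (hθA _) (hθc _) (zero_mem _) (zero_mul _)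
    (by rw [hθp]; exact (zero_mul p).symm)
  have hadd : ∀ x y, θ (x + y) = θ x + θ y := fun x y =>
    huniq _ _ (hθA _) (hθc _) (add_mem (hθA x) (hθA y)) (by rw [add_mul, hθc, hθc])
      (by rw [hθp, add_mul, hθp, hθp]; rfl)
  have hmul : ∀ x y, θ (x * y) = θ x * θ y := fun x y =>
    huniq _ _ (hθA _) (hθc _) (mul_mem (hθA x) (hθA y)) (by rw [mul_assoc, hθc])
      (by
        rw [hθp, mul_assoc, hθp]
        change (x : E →L[ℂ] E) * y = θ x * y
        rw [← hθp x, ← hθp y, mul_assoc, ← mul_assoc p,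
          mul_comm_of_mem_vnCenter (hθA y) (hNM p hpN), mul_assoc _ p, hpp])
  have hstar : ∀ x, θ (star x) = star (θ x) := fun x =>
    huniq _ _ (hθA _) (hθc _) (star_mem (hθA x))
      (by
        have := congrArg star (hθc x)
        rwa [star_mul, hc.isStarProjection.isSelfAdjoint.star_eq,
          mul_comm_of_mem_vnCenter (star_mem (hθA x)) (mem_of_mem_vnCenter hc.mem)] at this)
      (by
        rw [hθp]
        change star (x : E →L[ℂ] E) = star (θ x) * p
        rw [← hθp, star_mul, hps, mul_comm_of_mem_vnCenter (star_mem (hθA x)) (hNM p hpN)])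
  let Θ : vnCorner N p hp hpN →⋆ₙₐ[ℂ] vnCorner (vnCenter M) 1 (.one _) (one_mem _) :=
    { toFun := fun x => ⟨θ x, hmem x⟩
      map_smul' := fun t x => Subtype.ext (hsmul t x)
      map_zero' := Subtype.ext hzero
      map_add' := fun x y => Subtype.ext (hadd x y)
      map_mul' := fun x y => Subtype.ext (hmul x y)
      map_star' := fun x => Subtype.ext (hstar x) }
  refine ⟨p, 1, hp, .one _, hpN, one_mem _, hp0, ?_, Θ, p, ⟨p, hNM p hpN, ?_⟩, ?_, hp0, fun x => ?_⟩
  · intro h1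
    exact hp0 (by rw [← mul_one p, h1, mul_zero])
  · rw [one_mul, hpp]
  · rw [hps, hpp, hpp]
  · change θ x * p = p * x
    rw [hθp, ← hθp, ← mul_assoc, mul_comm_of_mem_vnCenter (hθA x) (hNM p hpN), mul_assoc, hpp]

end CentralCorner

/-! ### The finite index inequality -/

section Order

variable {E : Type*} [NormedAddCommGroup E] [InnerProductSpace ℂ E] [CompleteSpace E]

variable {M : VonNeumannAlgebra E} {p y z : E →L[ℂ] E}

/-- A central operator that is positive on `p` is positive on the central support of `p`. -/
theorem IsCentralSupport.nonneg_of_nonneg (hz : IsCentralSupport M p z) (hpM : p ∈ M)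
    (hp : IsStarProjection p) (hyA : y ∈ vnCenter M) (hy : IsSelfAdjoint y) (h : 0 ≤ p * y * p) :
    0 ≤ z * y := by
  have hpp : p * p = p := hp.isIdempotentElem
  have hps : star p = p := hp.isSelfAdjoint.star_eq
  have hns : star y⁻ = y⁻ := (CFC.negPart_nonneg y).isSelfAdjoint.star_eq
  have hnA : y⁻ ∈ vnCenter M := negPart_mem hyA
  have hnp : p * y⁻ = y⁻ * p := mul_comm_of_mem_vnCenter hnA hpM
  have hyn : y * y⁻ = -(y⁻ * y⁻) := by
    conv_lhs => rw [← CFC.posPart_sub_negPart y hy]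
    rw [sub_mul, CFC.posPart_sub_negPart y hy, CFC.posPart_mul_negPart, zero_sub]
  -- Conjugating p y p by y⁻ gives -p (y⁻)³ ≥ 0, while p (y⁻)³ is itself positive. So it vanishes,
  -- hence y⁻ p = 0, and y⁻ dies on the central support z.
  have h1 : 0 ≤ -(p * y⁻ * y⁻ * y⁻) := by
    have h2 := star_right_conjugate_nonneg h y⁻
    rw [hns] at h2
    have h3 : y⁻ * (p * y * p) * y⁻ = p * y⁻ * (y * y⁻) * p := by
      rw [mul_assoc _ (p * y * p), mul_assoc (p * y) p, hnp, ← mul_assoc, ← mul_assoc, ← mul_assoc,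
        ← hnp, ← mul_assoc, mul_assoc _ y y⁻]
    rw [h3, hyn, mul_neg, neg_mul, mul_assoc _ _ p, mul_assoc y⁻ y⁻ p, ← hnp, ← mul_assoc y⁻ p,
      ← hnp, mul_assoc p y⁻, ← mul_assoc y⁻ (p * _), ← mul_assoc y⁻ p, ← hnp] at h2
    simp only [← mul_assoc, hpp] at h2
    exact h2
  have h4 : 0 ≤ p * y⁻ * y⁻ * y⁻ := by
    have h2 := star_left_conjugate_nonneg (CFC.negPart_nonneg y) (y⁻ * p)
    rw [star_mul, hns, hps, mul_assoc _ y⁻ (y⁻ * p), ← hnp, ← mul_assoc y⁻ p, ← hnp,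
      mul_assoc p y⁻ y⁻, mul_assoc p, ← mul_assoc y⁻ p, ← hnp] at h2
    simp only [← mul_assoc, hpp] at h2
    exact h2
  have h5 : p * y⁻ * y⁻ * y⁻ = 0 := le_antisymm (neg_nonneg.1 h1) h4
  have h6 : p * (y⁻ * y⁻) = 0 := by
    refine mul_eq_zero_of_mul_mul_eq_zero (b := y⁻ * y⁻) (by rw [star_mul, hns]) ?_
    rw [← mul_assoc, ← mul_assoc, ← mul_assoc, h5, zero_mul]
  have h7 : y⁻ * p = 0 := by rw [← hnp, mul_eq_zero_of_mul_mul_eq_zero hns h6]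
  have h8 : z * y⁻ = 0 := by
    rw [mul_comm_of_mem_vnCenter hnA (mem_of_mem_vnCenter hz.mem), hz.mul_eq_zero _ hnA h7]
  have h9 : z * y = z * y⁺ := by
    conv_lhs => rw [← CFC.posPart_sub_negPart y hy]
    rw [mul_sub, h8, sub_zero]
  rw [h9]
  refine mul_nonneg_of_isStarProjection hz.isStarProjection (CFC.posPart_nonneg y) ?_
  exact mul_comm_of_mem_vnCenter hz.mem (posPart_mem (mem_of_mem_vnCenter hyA))

/-- The pinching inequality. -/
theorem le_card_smul_sum_pinching {T : Type*} [Fintype T] {Q : T → E →L[ℂ] E}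
    (hQ : ∀ t, star (Q t) = Q t) (hsum : ∑ t, Q t = 1) (hp : 0 ≤ p) :
    p ≤ (Fintype.card T) • ∑ t, Q t * p * Q t := by
  have h1 : 0 ≤ ∑ s, ∑ t, (Q s - Q t) * p * (Q s - Q t) :=
    Finset.sum_nonneg fun s _ => Finset.sum_nonneg fun t _ => by
      have := star_right_conjugate_nonneg hp (Q s - Q t)
      rwa [star_sub, hQ, hQ] at this
  have h2 : ∑ s, ∑ t, (Q s - Q t) * p * (Q s - Q t) =
      (2 : ℝ) • ((Fintype.card T) • ∑ t, Q t * p * Q t - p) := by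
    have e1 : ∑ s, ∑ _t : T, Q s * p * Q s = (Fintype.card T) • ∑ t, Q t * p * Q t := by
      simp only [Finset.sum_const, Finset.card_univ, Finset.smul_sum]
    have e2 : ∑ s, ∑ t, Q s * p * Q t = p := by
      simp only [← Finset.mul_sum, hsum, mul_one, ← Finset.sum_mul, one_mul]
    have e3 : ∑ s, ∑ t, Q t * p * Q s = p := by rw [Finset.sum_comm, e2]
    have e4 : ∑ _s : T, ∑ t, Q t * p * Q t = (Fintype.card T) • ∑ t, Q t * p * Q t := by
      rw [Finset.sum_const, Finset.card_univ]
    simp only [sub_mul, mul_sub, Finset.sum_sub_distrib]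
    rw [e1, e2, e3, e4]
    module
  rw [h2] at h1
  rw [← sub_nonneg]
  have := smul_nonneg (show (0 : ℝ) ≤ 1 / 2 by norm_num) h1
  rwa [smul_smul, show (1 / 2 * 2 : ℝ) = 1 by norm_num, one_smul] at this

theorem isStarProjection_list_sum {l : List (E →L[ℂ] E)}
    (hl : ∀ q ∈ l, IsStarProjection q) (horth : l.Pairwise fun a b => a * b = 0) :
    IsStarProjection l.sum := by
  induction l with
  | nil => exact .zero _
  | cons q l ih =>
    rw [List.pairwise_cons] at horth
    rw [List.sum_cons]
    refine (hl q List.mem_cons_self).add (ih (fun r hr => hl r (List.mem_cons_of_mem _ hr)) horth.2) ?_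
    have : ∀ l' : List (E →L[ℂ] E),
        (∀ b ∈ l', q * b = 0) → q * l'.sum = 0 := by
      intro l' hl'
      induction l' with
      | nil => simp
      | cons a l' ih =>
        rw [List.sum_cons, mul_add, hl' a List.mem_cons_self, zero_add]
        exact ih fun b hb => hl' b (List.mem_cons_of_mem _ hb)
    exact this l horth.1

end Order

/-! ### The trace and the bound on families with equal central support -/

section Trace

variable {H : Type*} [Group H]

open scoped InnerProductSpace

/-- The real part of the canonical trace. -/
noncomputable def traceRe (x : lp (fun _ : H => ℂ) 2 →L[ℂ] lp (fun _ : H => ℂ) 2) : ℝ :=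
  (coef x 1 1).re

variable {x y z : lp (fun _ : H => ℂ) 2 →L[ℂ] lp (fun _ : H => ℂ) 2}

theorem traceRe_nonneg (hx : 0 ≤ x) : 0 ≤ traceRe x := by
  have h := ((ContinuousLinearMap.nonneg_iff_isPositive x).1 hx).re_inner_nonneg_right (delta 1)
  rwa [inner_delta_apply_delta] at h

theorem traceRe_add (x y : lp (fun _ : H => ℂ) 2 →L[ℂ] lp (fun _ : H => ℂ) 2) :
    traceRe (x + y) = traceRe x + traceRe y := rfl

theorem traceRe_sub (x y : lp (fun _ : H => ℂ) 2 →L[ℂ] lp (fun _ : H => ℂ) 2) :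
    traceRe (x - y) = traceRe x - traceRe y := rfl

theorem traceRe_nsmul (n : ℕ) (x : lp (fun _ : H => ℂ) 2 →L[ℂ] lp (fun _ : H => ℂ) 2) :
    traceRe (n • x) = n * traceRe x := by
  rw [← Nat.cast_smul_eq_nsmul ℂ, traceRe, coef_smul, ← Complex.ofReal_natCast,
    Complex.re_ofReal_mul, traceRe]

theorem traceRe_mono (h : x ≤ y) : traceRe x ≤ traceRe y := by
  have := traceRe_nonneg (sub_nonneg.2 h)
  rwa [traceRe_sub, sub_nonneg] at this

/-- The trace of a projection x is ‖x δ_1‖², and δ_1 is separating for `L(H)`. -/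
theorem traceRe_pos (hx : IsStarProjection x) (hxM : x ∈ groupVN (⊤ : Subgroup H)) (hx0 : x ≠ 0) :
    0 < traceRe x := by
  have h1 : coef x 1 1 = ⟪x (delta 1), x (delta 1)⟫_ℂ := by
    have hxx : x * x = x := hx.isIdempotentElem
    rw [← inner_delta_apply_delta]
    conv_lhs => rw [← hxx, mul_apply_eq_comp]
    rw [← ContinuousLinearMap.adjoint_inner_left, ← ContinuousLinearMap.star_eq_adjoint,
      hx.isSelfAdjoint.star_eq]
  have h2 : traceRe x = ‖x (delta 1)‖ ^ 2 := by
    rw [traceRe, h1]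
    exact (norm_sq_eq_re_inner (𝕜 := ℂ) _).symm
  rw [h2]
  have h3 : x (delta 1) ≠ 0 := by
    intro h0
    refine hx0 (eq_of_coef fun h g => ?_)
    rw [mem_groupVN_top_iff.1 hxM, coef, h0]
    rfl
  positivity

/-- Each member has trace at least τ(z)/C, and their sum is a projection below z, with τ(z) > 0. -/
theorem IsEqualSupportFamily.length_le {N : VonNeumannAlgebra (lp (fun _ : H => ℂ) 2)}
    {e : lp (fun _ : H => ℂ) 2 →L[ℂ] lp (fun _ : H => ℂ) 2}
    {l : List (lp (fun _ : H => ℂ) 2 →L[ℂ] lp (fun _ : H => ℂ) 2)} {C : ℕ}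
    (hC : ∀ p ∈ N, IsStarProjection p → e * p = p →
      ∀ z, IsCentralSupport (groupVN (⊤ : Subgroup H)) p z → traceRe z ≤ C * traceRe p)
    (h : IsEqualSupportFamily (groupVN (⊤ : Subgroup H)) N e z l) : l.length ≤ C := by
  rcases l with _ | ⟨q, l⟩
  · exact Nat.zero_le _
  set L := q :: l with hL
  have hz := (h.mem q List.mem_cons_self).2.2.2
  have hzpos := traceRe_pos hz.isStarProjection (mem_of_mem_vnCenter hz.mem) h.ne_zero
  have hgen : ∀ l' : List (lp (fun _ : H => ℂ) 2 →L[ℂ] lp (fun _ : H => ℂ) 2), (∀ b ∈ l', b ∈ L) →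
      z * l'.sum = l'.sum ∧ l'.length * traceRe z ≤ C * traceRe l'.sum := by
    intro l' hl'
    induction l' with
    | nil => simp [traceRe, coef]
    | cons a l' ih =>
      obtain ⟨h1, h2⟩ := ih fun b hb => hl' b (List.mem_cons_of_mem _ hb)
      obtain ⟨haN, hap, hea, haz⟩ := h.mem a (hl' a List.mem_cons_self)
      have h3 := hC a haN hap hea z haz
      rw [List.sum_cons, mul_add, h1, haz.mul_eq, traceRe_add, List.length_cons]
      refine ⟨rfl, ?_⟩
      push_cast
      linarith
  obtain ⟨h1, h2⟩ := hgen L fun _ hb => hb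
  have hs := isStarProjection_list_sum (fun a ha => (h.mem a ha).2.1) h.pairwise
  have h3 : traceRe L.sum ≤ traceRe z := by
    refine traceRe_mono ?_
    rw [← sub_nonneg]
    exact (hs.sub_of_mul_eq_right hz.isStarProjection h1).nonneg
  have h4 : (L.length : ℝ) * traceRe z ≤ C * traceRe z := h2.trans (by gcongr)
  exact_mod_cast le_of_mul_le_mul_right h4 hzpos

end Trace

/-! ### Expectation onto `L(K)` and averages over finite subgroups -/

section FiniteIndex

variable {H : Type*} [Group H]

variable {x y z : lp (fun _ : H => ℂ) 2 →L[ℂ] lp (fun _ : H => ℂ) 2}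

/-- A finite partition of `H` which on each right coset of `S` is the partition into the cosets
of `K`. -/
theorem exists_cosetLabel (K S : Subgroup H) [K.Normal] [(K.subgroupOf S).FiniteIndex] :
    ∃ (n : ℕ) (φ : H → Fin n),
      ∀ h g : H, h * g⁻¹ ∈ S → (φ h = φ g ↔ h * g⁻¹ ∈ K) := by
  let σ : H → H := fun h => (Quotient.mk (QuotientGroup.rightRel S) h).out
  have hσ : ∀ h, h * (σ h)⁻¹ ∈ S := fun h =>
    QuotientGroup.rightRel_apply.1 (Quotient.mk_out (s := QuotientGroup.rightRel S) h)
  -- The label of h is the class in S/K of h σ(h)⁻¹, where σ(h) represents the right coset S h.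
  -- Normality of K turns equality of labels into h g⁻¹ ∈ K.
  refine ⟨_, fun h => Finite.equivFin (S ⧸ K.subgroupOf S) (QuotientGroup.mk ⟨h * (σ h)⁻¹, hσ h⟩), ?_⟩
  intro h g hhg
  have hhg' : σ h = σ g := by
    simp only [σ]
    congr 1
    exact Quotient.sound (s := QuotientGroup.rightRel S) (QuotientGroup.rightRel_apply.2 (by
      have := S.inv_mem hhg
      rwa [mul_inv_rev, inv_inv] at this))
  rw [(Finite.equivFin _).injective.eq_iff, QuotientGroup.eq, Subgroup.mem_subgroupOf]
  simp only [Subgroup.coe_mul, Subgroup.coe_inv]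
  rw [Subgroup.Normal.mem_comm_iff inferInstance, hhg', mul_inv_rev, inv_inv,
    show g * (σ g)⁻¹ * (σ g * h⁻¹) = (h * g⁻¹)⁻¹ by group, inv_mem_iff]

/-- The conditional expectation onto `L(K)` of a positive element of `L(S)` dominates a multiple of
that element. -/
theorem exists_expectation (K S : Subgroup H) [K.Normal] [(K.subgroupOf S).FiniteIndex] :
    ∃ n : ℕ, ∀ p ∈ groupVN S, 0 ≤ p → ∃ b ∈ groupVN K, 0 ≤ b ∧ p ≤ n • b ∧
      ∀ k ∈ K, coef b k 1 = coef p k 1 := by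
  classical
  obtain ⟨n, φ, hφ⟩ := exists_cosetLabel K S
  refine ⟨n, fun p hpS hp => ?_⟩
  -- Pinching by the label sets keeps exactly the coefficients with h g⁻¹ in K: those with h g⁻¹
  -- outside S vanish already, and inside S labels detect cosets of K.
  have hcoef : ∀ h g, coef (∑ t, indicatorOp (φ ⁻¹' {t}) * p * indicatorOp (φ ⁻¹' {t})) h g =
      if h * g⁻¹ ∈ K then coef p h g else 0 := by
    intro h g
    rw [coef_sum]
    simp only [coef_indicatorOp_mul_mul, Set.mem_preimage, Set.mem_singleton_iff]
    by_cases hS : h * g⁻¹ ∈ S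
    · rw [← if_congr (hφ h g hS) rfl rfl]
      by_cases hhg : φ h = φ g
      · simp [hhg]
      · rw [if_neg hhg]
        refine Finset.sum_eq_zero fun t _ => if_neg ?_
        rintro ⟨rfl, h2⟩
        exact hhg h2.symm
    · have h0 : coef p h g = 0 := by
        rw [coef_eq_of_mem_groupVN hpS, coef_eq_zero_of_mem_groupVN hpS hS]
      simp [h0]
  refine ⟨∑ t, indicatorOp (φ ⁻¹' {t}) * p * indicatorOp (φ ⁻¹' {t}), ?_, ?_, ?_, ?_⟩
  · refine mem_groupVN_iff.2 ⟨fun h g => ?_, fun h hh => ?_⟩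
    · rw [hcoef, hcoef, inv_one, mul_one, coef_eq_of_mem_groupVN hpS]
    · rw [hcoef, inv_one, mul_one, if_neg hh]
  · refine Finset.sum_nonneg fun t _ => ?_
    have := star_right_conjugate_nonneg hp (indicatorOp (φ ⁻¹' {t}))
    rwa [star_indicatorOp] at this
  · have h1 := le_card_smul_sum_pinching (Q := fun t => indicatorOp (φ ⁻¹' {t}))
      (fun t => star_indicatorOp _) (eq_of_delta fun g => ?_) hp
    · rwa [Fintype.card_fin] at h1
    rw [sum_apply, Finset.sum_eq_single (φ g),
      indicatorOp_delta_of_mem (T := φ ⁻¹' {φ g}) (Set.mem_singleton _)]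
    · rfl
    · exact fun t _ ht => indicatorOp_delta_of_notMem fun h => ht h.symm
    · simp
  · intro k hk
    rw [hcoef, inv_one, mul_one, if_pos hk]

/-- The projection onto the vectors invariant under a finite subgroup. -/
noncomputable def averageOp (F : Subgroup H) [Fintype F] :
    lp (fun _ : H => ℂ) 2 →L[ℂ] lp (fun _ : H => ℂ) 2 :=
  ((Fintype.card F : ℂ)⁻¹) • ∑ f : F, leftTranslation (f : H)

variable (F : Subgroup H) [Fintype F]

theorem leftTranslation_mul_averageOp (f : F) : leftTranslation (f : H) * averageOp F = averageOp F := by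
  rw [averageOp, mul_smul_comm, Finset.mul_sum]
  congr 1
  refine Fintype.sum_equiv (Equiv.mulLeft f) _ _ fun g => ?_
  rw [← leftTranslation_mul]
  rfl

theorem averageOp_mul_leftTranslation (f : F) : averageOp F * leftTranslation (f : H) = averageOp F := by
  rw [averageOp, smul_mul_assoc, Finset.sum_mul]
  congr 1
  refine Fintype.sum_equiv (Equiv.mulRight f) _ _ fun g => ?_
  rw [← leftTranslation_mul]
  rfl

theorem isStarProjection_averageOp : IsStarProjection (averageOp F) := by
  refine ⟨?_, ?_⟩
  · rw [IsIdempotentElem]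
    conv_lhs => enter [1]; rw [averageOp]
    rw [smul_mul_assoc, Finset.sum_mul]
    simp only [leftTranslation_mul_averageOp, Finset.sum_const, Finset.card_univ]
    rw [← Nat.cast_smul_eq_nsmul ℂ, smul_smul, inv_mul_cancel₀, one_smul]
    exact_mod_cast Fintype.card_ne_zero
  · rw [IsSelfAdjoint, averageOp, star_smul, star_sum]
    congr 1
    · simp
    · refine Fintype.sum_equiv (Equiv.inv F) _ _ fun g => ?_
      rw [star_leftTranslation]
      rfl

theorem averageOp_mem_groupVN : averageOp F ∈ groupVN F :=
  (groupVN F).toStarSubalgebra.smul_mem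
    (sum_mem fun f _ => leftTranslation_mem_groupVN f.2) _

theorem coef_mul_averageOp (h g : H) :
    coef (x * averageOp F) h g = (Fintype.card F : ℂ)⁻¹ * ∑ f : F, coef x h (f * g) := by
  rw [averageOp, mul_smul_comm, coef_smul, Finset.mul_sum, coef_sum]
  simp only [coef_mul_leftTranslation]

theorem averageOp_ne_zero : averageOp F ≠ 0 := by
  classical
  intro h0
  have h1 := coef_mul_averageOp (x := (1 : lp (fun _ : H => ℂ) 2 →L[ℂ] lp (fun _ : H => ℂ) 2)) F 1 1
  rw [one_mul, h0] at h1
  have h2 : ∀ f : F, coef (1 : lp (fun _ : H => ℂ) 2 →L[ℂ] lp (fun _ : H => ℂ) 2) 1 ((f : H) * 1) =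
      if f = 1 then 1 else 0 := by
    intro f
    rw [coef, one_apply_eq_self, mul_one]
    by_cases hf : f = 1
    · rw [hf, if_pos rfl]; exact delta_apply_self _
    · rw [if_neg hf]
      exact delta_apply_ne fun h => hf (Subtype.ext h.symm)
  rw [Finset.sum_congr rfl fun f _ => h2 f, Finset.sum_ite_eq', if_pos (Finset.mem_univ _), mul_one] at h1
  have h3 : (0 : ℂ) = (Fintype.card F : ℂ)⁻¹ := h1
  rw [eq_comm, inv_eq_zero, Nat.cast_eq_zero] at h3
  exact Fintype.card_ne_zero h3

theorem averageOp_mem_vnCenter [F.Normal] : averageOp F ∈ vnCenter (groupVN (⊤ : Subgroup H)) := by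
  refine ⟨groupVN_mono le_top (averageOp_mem_groupVN F),
    VonNeumannAlgebra.mem_commutant_iff.2 fun y hy => commute_of_mem_groupVN hy fun s _ => ?_⟩
  rw [averageOp, mul_smul_comm, smul_mul_assoc, Finset.mul_sum, Finset.sum_mul]
  congr 1
  refine Fintype.sum_equiv (MulAut.conjNormal s).toEquiv _ _ fun f => ?_
  rw [← leftTranslation_mul, ← leftTranslation_mul]
  congr 1
  simp

end FiniteIndex

/-! ### Trace comparison with the central support -/

section CentralAverage

variable {H : Type*} [Group H]

variable {w : lp (fun _ : H => ℂ) 2 →L[ℂ] lp (fun _ : H => ℂ) 2}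

theorem coef_conj_leftTranslation (hw : w ∈ groupVN (⊤ : Subgroup H)) (g h : H) :
    coef (leftTranslation g * w * leftTranslation g⁻¹) h 1 = coef w (g⁻¹ * h * g) 1 := by
  rw [coef_mul_leftTranslation, coef_leftTranslation_mul, mem_groupVN_top_iff.1 hw, mul_one, inv_inv]

/-- An element of the group von Neumann algebra that is invariant under conjugation by a normal
subgroup of finite index is dominated by a central element of comparable trace. -/
theorem exists_central_average (L : Subgroup H) [L.Normal] [L.FiniteIndex]
    (hw : w ∈ groupVN (⊤ : Subgroup H)) (hw0 : 0 ≤ w)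
    (hL : ∀ l ∈ L, ∀ h, coef w (l * h * l⁻¹) 1 = coef w h 1) :
    ∃ a ∈ vnCenter (groupVN (⊤ : Subgroup H)), 0 ≤ a ∧ w ≤ a ∧
      traceRe a = L.index * traceRe w := by
  classical
  let _ : Fintype (H ⧸ L) := Fintype.ofFinite _
  -- By L-invariance, the conjugate of w by g depends only on the coset of g. The sum over H/L is
  -- therefore central, and it dominates its term w at the trivial coset.
  have hinv : ∀ g g' : H, (g : H ⧸ L) = g' → ∀ h,
      coef w (g⁻¹ * h * g) 1 = coef w (g'⁻¹ * h * g') 1 := by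
    intro g g' hgg h
    have h1 := hL (g⁻¹ * g') (QuotientGroup.eq.1 hgg) (g'⁻¹ * h * g')
    rw [← h1]
    congr 1
    group
  let u : H ⧸ L → lp (fun _ : H => ℂ) 2 →L[ℂ] lp (fun _ : H => ℂ) 2 := fun q =>
    leftTranslation q.out * w * leftTranslation q.out⁻¹
  have hu0 : ∀ q, 0 ≤ u q := by
    intro q
    have := star_right_conjugate_nonneg hw0 (leftTranslation q.out)
    rwa [star_leftTranslation] at this
  have huM : ∀ q, u q ∈ groupVN (⊤ : Subgroup H) := fun q =>
    mul_mem (mul_mem (leftTranslation_mem_groupVN (Subgroup.mem_top _)) hw)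
      (leftTranslation_mem_groupVN (Subgroup.mem_top _))
  have hu1 : u (1 : H) = w := by
    refine eq_of_coef fun h g => ?_
    rw [mem_groupVN_top_iff.1 (huM _), mem_groupVN_top_iff.1 hw, coef_conj_leftTranslation hw,
      hinv _ 1 (QuotientGroup.out_eq' _)]
    group
  refine ⟨∑ q, u q, mem_vnCenter_groupVN_iff.2 ⟨sum_mem fun q _ => huM q, fun k h => ?_⟩,
    Finset.sum_nonneg fun q _ => hu0 q, ?_, ?_⟩
  · rw [coef_sum, coef_sum]
    symm
    refine Fintype.sum_equiv (MulAction.toPerm k) _ _ fun q => ?_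
    rw [coef_conj_leftTranslation hw, coef_conj_leftTranslation hw, MulAction.toPerm_apply,
      ← hinv (k * q.out) (k • q).out]
    · congr 1
      group
    · rw [QuotientGroup.out_eq']
      conv_rhs => rw [← QuotientGroup.out_eq' q]
      rfl
  · rw [← hu1]
    exact Finset.single_le_sum (fun q _ => hu0 q) (Finset.mem_univ _)
  · have h1 : coef (∑ q, u q) 1 1 = L.index * coef w 1 1 := by
      rw [coef_sum]
      have : ∀ q, coef (u q) 1 1 = coef w 1 1 := fun q => by
        rw [coef_conj_leftTranslation hw, mul_one, inv_mul_cancel]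
      simp only [this, Finset.sum_const, Finset.card_univ, nsmul_eq_mul]
      rw [Subgroup.index, Nat.card_eq_fintype_card]
    rw [traceRe, h1, ← Complex.ofReal_natCast, Complex.re_ofReal_mul, traceRe]

/-- Projections in `L(S)` below `averageOp F` have comparable trace to their central supports. -/
theorem exists_traceRe_centralSupport_le {K S L F : Subgroup H} [K.Normal] [L.Normal]
    [L.FiniteIndex] [F.Normal] [Fintype F] [(K.subgroupOf S).FiniteIndex] (hFK : F ≤ K)
    (hF : ∀ l ∈ L, ∀ k ∈ K, l * k * l⁻¹ * k⁻¹ ∈ F) :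
    ∃ C : ℕ, ∀ p ∈ groupVN S, IsStarProjection p → averageOp F * p = p →
      ∀ z, IsCentralSupport (groupVN (⊤ : Subgroup H)) p z → traceRe z ≤ C * traceRe p := by
  obtain ⟨n, hn⟩ := exists_expectation K S
  refine ⟨n * L.index, fun p hpS hp hep z hz => ?_⟩
  have hpM := groupVN_mono le_top hpS
  have hpp : p * p = p := hp.isIdempotentElem
  have hps : star p = p := hp.isSelfAdjoint.star_eq
  obtain ⟨b, hbK, hb0, hpb, hbp⟩ := hn p hpS hp.nonneg
  have hbM := groupVN_mono le_top hbK
  have heA := averageOp_mem_vnCenter F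
  have he := isStarProjection_averageOp F
  have hbe : b * averageOp F = averageOp F * b := mul_comm_of_mem_vnCenter heA hbM
  have hwK : b * averageOp F ∈ groupVN K :=
    mul_mem hbK (groupVN_mono hFK (averageOp_mem_groupVN F))
  have hwM := groupVN_mono le_top hwK
  have hw0 : 0 ≤ b * averageOp F := by
    rw [hbe]
    exact mul_nonneg_of_isStarProjection he hb0 hbe
  have hpe : p * averageOp F = p := by rw [mul_comm_of_mem_vnCenter heA hpM, hep]
  -- For h in K, l h l⁻¹ = h f with f in F, and b e_F absorbs u_f; outside K both coefficients
  -- vanish.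
  have hwL : ∀ l ∈ L, ∀ h, coef (b * averageOp F) (l * h * l⁻¹) 1 = coef (b * averageOp F) h 1 := by
    intro l hl h
    by_cases hh : h ∈ K
    · have hf : h⁻¹ * l * h * l⁻¹ ∈ F := by
        have h1 := hF l hl h⁻¹ (K.inv_mem hh)
        have h2 := F.inv_mem h1
        rw [show h⁻¹ * l * h * l⁻¹ = (l * h⁻¹ * l⁻¹ * h⁻¹⁻¹)⁻¹ by group]
        exact h2
      have h3 := congrArg (fun x => coef (b * x) (l * h * l⁻¹) 1)
        (averageOp_mul_leftTranslation F ⟨_, hf⟩)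
      simp only [← mul_assoc, coef_mul_leftTranslation] at h3
      rw [← h3, mem_groupVN_top_iff.1 hwM]
      congr 1
      group
    · rw [coef_eq_zero_of_mem_groupVN hwK hh, coef_eq_zero_of_mem_groupVN hwK]
      intro h1
      refine hh ?_
      have := Subgroup.Normal.conj_mem inferInstance _ h1 l⁻¹
      rwa [show l⁻¹ * (l * h * l⁻¹) * l⁻¹⁻¹ = h by group] at this
  have htr : traceRe (b * averageOp F) = traceRe p := by
    have : coef (b * averageOp F) 1 1 = coef (p * averageOp F) 1 1 := by
      rw [coef_mul_averageOp, coef_mul_averageOp]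
      congr 1
      refine Finset.sum_congr rfl fun f _ => ?_
      rw [mem_groupVN_top_iff.1 hbM, mem_groupVN_top_iff.1 hpM,
        hbp _ (K.mul_mem K.one_mem (K.inv_mem (K.mul_mem (hFK f.2) K.one_mem)))]
    rw [traceRe, this, hpe, traceRe]
  obtain ⟨a, haA, ha0, hwa, hatr⟩ := exists_central_average L hwM hw0 hwL
  have hzz := hz.isStarProjection
  have hzM := mem_of_mem_vnCenter hz.mem
  -- Compressing p ≤ n b by p and inserting e_F (as e_F p = p) gives p ≤ n p (b e_F) p ≤ n p a p.
  -- Since a is central, positivity passes from p to z: z ≤ n z a, and then traces are compared.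
  have hpos : 0 ≤ p * (n • a - 1) * p := by
    have h1 : p ≤ n • (p * (b * averageOp F) * p) := by
      have h2 := star_right_conjugate_le_conjugate hpb p
      rw [hps, hpp, hpp] at h2
      rw [mul_smul_comm, smul_mul_assoc] at h2
      rwa [← mul_assoc, mul_assoc (p * b), hep]
    have h2 : n • (p * (b * averageOp F) * p) ≤ n • (p * a * p) := by
      have h3 := star_right_conjugate_le_conjugate hwa p
      rw [hps] at h3
      exact nsmul_le_nsmul_right h3 n
    have h3 : p * (n • a - 1) * p = n • (p * a * p) - p := by
      rw [mul_sub, sub_mul, mul_one, hpp, mul_smul_comm, smul_mul_assoc]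
    rw [h3, sub_nonneg]
    exact h1.trans h2
  have hyA : n • a - 1 ∈ vnCenter (groupVN (⊤ : Subgroup H)) :=
    sub_mem (nsmul_mem haA n) (one_mem _)
  have hysa : IsSelfAdjoint (n • a - 1) :=
    (nsmul_nonneg ha0 n).isSelfAdjoint.sub (.one _)
  have h1 := traceRe_nonneg (hz.nonneg_of_nonneg hpM hp hyA hysa hpos)
  have h2 : traceRe (z * a) ≤ traceRe a := by
    have h3 := traceRe_nonneg (mul_nonneg_of_isStarProjection hzz.one_sub ha0 (by
      rw [mul_sub, sub_mul, mul_one, one_mul, mul_comm_of_mem_vnCenter hz.mem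
        (mem_of_mem_vnCenter haA)]))
    rwa [sub_mul, one_mul, traceRe_sub, sub_nonneg] at h3
  rw [mul_sub, mul_one, mul_smul_comm, traceRe_sub, traceRe_nsmul, sub_nonneg] at h1
  rw [hatr, htr] at h2
  push_cast
  calc traceRe z ≤ n * traceRe (z * a) := h1
    _ ≤ n * (L.index * traceRe p) := by gcongr
    _ = _ := by ring

end CentralAverage

/-! ### Assembly of the two implications -/

section HyperFC

open scoped commutatorElement

universe u

theorem fcCenter_le_hyperFCCenter (H : Type u) [Group H] : fcCenter H ≤ hyperFCCenter H := by
  have h1 : (upperFCSeries H (0 + 1)).1 = 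
      (fcStep ⟨⊥, inferInstance⟩ : {N : Subgroup H // N.Normal}).1 := by
    rw [upperFCSeries, Ordinal.limitRecOn_add_one, Ordinal.limitRecOn_zero]
  refine le_trans ?_ (le_iSup (fun α : Ordinal.{u} => (upperFCSeries H α).1) (0 + 1))
  rw [h1]
  intro g hg
  change (conjClass (QuotientGroup.mk' (⊥ : Subgroup H) g)).Finite
  refine (Set.Finite.image (QuotientGroup.mk' (⊥ : Subgroup H)) hg).subset ?_
  rintro _ ⟨h, rfl⟩
  obtain ⟨h, rfl⟩ := QuotientGroup.mk'_surjective _ h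
  exact ⟨h * g * h⁻¹, ⟨h, rfl⟩, by simp⟩

variable {H : Type*} [Group H]

/-- A central element has square-summable coefficients constant on classes, so it vanishes on
infinite ones. This makes the center available inside `L(S)` for cutting projections. -/
theorem vnCenter_le_groupVN {S : Subgroup H} (hS : fcCenter H ≤ S)
    {x : lp (fun _ : H => ℂ) 2 →L[ℂ] lp (fun _ : H => ℂ) 2}
    (hx : x ∈ vnCenter (groupVN (⊤ : Subgroup H))) : x ∈ groupVN S :=
  mem_groupVN_iff.2 ⟨mem_groupVN_top_iff.1 (mem_of_mem_vnCenter hx), fun _ hh =>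
    coef_eq_zero_of_mem_vnCenter hx fun h => hh (hS h)⟩

theorem intertwines_of_isBFCInside {S : Subgroup H} (hS : fcCenter H ≤ S)
    (hBFC : IsBFCInside (fcCenter H)) (hfin : ((fcCenter H).subgroupOf S).FiniteIndex) :
    Intertwines (groupVN (⊤ : Subgroup H)) (groupVN S) (vnCenter (groupVN (⊤ : Subgroup H))) := by
  obtain ⟨L, hL, hLi, hKL, hF⟩ := hBFC.exists_finite_mixed_commutator
  let _ : Fintype (⁅L, fcCenter H⁆ : Subgroup H) := Fintype.ofFinite _
  obtain ⟨C, hC⟩ := exists_traceRe_centralSupport_le (S := S) (F := ⁅L, fcCenter H⁆)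
    (Subgroup.commutator_le_right L (fcCenter H))
    (fun l hl k hk => Subgroup.commutator_mem_commutator hl hk)
  have hNM : ∀ x ∈ groupVN S, x ∈ groupVN (⊤ : Subgroup H) := fun x hx => groupVN_mono le_top hx
  obtain ⟨p, hpN, hp, hp0, hhom⟩ := exists_isCentrallyHomogeneous hNM
    (fun x hx => vnCenter_le_groupVN hS hx) (isStarProjection_averageOp _)
    (averageOp_mem_vnCenter ⁅L, fcCenter H⁆) (averageOp_ne_zero _)
    (fun z l hl => hl.length_le hC)
  exact intertwines_vnCenter_of_corner hNM hpN hp hp0 fun y hy => hhom.corner_subset hNM hpN hp hy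

end HyperFC

theorem mainTheorem8 (H : Type*) [Group H] [Countable H] :
    ((IsBFCInside (fcCenter H) ∧ ((fcCenter H).subgroupOf (hyperFCCenter H)).FiniteIndex) ↔
      Intertwines (groupVN (⊤ : Subgroup H)) (groupVN (hyperFCCenter H))
        (vnCenter (groupVN (⊤ : Subgroup H)))) ∧
    (Intertwines (groupVN (⊤ : Subgroup H)) (groupVN (fcCenter H))
        (vnCenter (groupVN (⊤ : Subgroup H))) →
      Finite (⁅fcCenter H, fcCenter H⁆ : Subgroup H)) := by
  refine ⟨⟨fun h => intertwines_of_isBFCInside (fcCenter_le_hyperFCCenter H) h.1 h.2,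
    fun h => ⟨h.isBFCInside_fcCenter (fcCenter_le_hyperFCCenter H), h.finiteIndex_fcCenter⟩⟩,
    fun h => (h.isBFCInside_fcCenter le_rfl).finite_commutator⟩
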